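/- Let $P$ be a pair of pants with $\pi_1(P)=\langle\alpha,\beta,\gamma\mid\alpha\beta\gamma=1\rangle$, where $\alpha,\beta,\gamma$ are the three boundary curves, and let $\delta=\alpha\gamma^{-1}$ be the figure eight curve. Let $\widehat{\mathfrak C}(P)$ be the space of framed convex projective structures on $P$, identified through the framed holonomy with the space of positive framed representations: conjugacy classes of tuples $(\rho,F_\alpha,F_\beta,F_\gamma)$, where $\rho\colon\pi_1(P)\to \mathrm{PSL}(3,\mathbb R)$ is a representation and $F_\alpha,F_\beta,F_\gamma$ are full flags of $\mathbb R^3$ fixed by $\rho(\alpha),\rho(\beta),\rho(\gamma)$ respectively, such that the eight Fock–Goncharov coordinates $(X_1,\dots,X_8)=(\sigma_1,\dots,\sigma_6,\tau_1,\tau_2)$ (two cross ratios for each of the three edges and one triple ratio for each of the two triangles of the ideal triangulation of $P$ by two triangles, each with one vertex at every puncture) are positive. Explicitly, for flags $F_i=(p_i,\ell_i)$ (a point $p_i$ and a line $\ell_i$ given by a row vector) put $$\mathrm{cr}_1(F_1,F_2,F_3,F_4)=-\frac{\ell_1(p_2)\,\overline{p_1p_3}(p_4)}{\ell_1(p_4)\,\overline{p_1p_3}(p_2)},\qquad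 \mathrm{cr}_2(F_1,F_2,F_3,F_4)=\mathrm{cr}_1(F_3,F_4,F_1,F_2),\qquad \mathsf T(F_1,F_2,F_3)=\frac{\ell_1(p_2)\ell_2(p_3)\ell_3(p_1)}{\ell_1(p_3)\ell_2(p_1)\ell_3(p_2)};$$ with $(A,B,C)=(F_\alpha,F_\beta,F_\gamma)$ and $A'=\rho(\gamma)A$, $B'=\rho(\alpha)B$, $C'=\rho(\beta)C$, the coordinates are $(\sigma_2,\sigma_1)=(\mathrm{cr}_1,\mathrm{cr}_2)(A,B',C,B)$, $(\sigma_3,\sigma_4)=(\mathrm{cr}_1,\mathrm{cr}_2)(A,C,B,C')$, $(\sigma_6,\sigma_5)=(\mathrm{cr}_1,\mathrm{cr}_2)(C,A',B,A)$, $\tau_1=\mathsf T(A,C,B)$, $\tau_2=\mathsf T(A,B',C)$; they identify $\widehat{\mathfrak C}(P)$ with $\mathbb R_{>0}^8$. The smooth structure of $\widehat{\mathfrak C}(P)$ is the one given by these coordinates, and its Poisson bracket is determined by $\{X_i,X_j\}=2\varepsilon_{ij}X_iX_j$, where $\varepsilon$ is the antisymmetric matrix with $\varepsilon_{i7}=(-1)^{i+1}$,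 $\varepsilon_{i8}=(-1)^{i}$ for $1\le i\le 6$, $\varepsilon_{ij}=0$ for $1\le i,j\le 6$, and $\varepsilon_{78}=0$. The Hamiltonian vector field $H_f$ of a smooth function $f$ is defined by $dg(H_f)=\{g,f\}$ for all smooth $g$, and the symplectic leaves are the sets of all points that can be reached from a given point by finite compositions of time-one flows of Hamiltonian vector fields, with the induced symplectic structure. For $c\in\pi_1(P)$ let $\mathrm{tr}_c[\rho,F_\alpha,F_\beta,F_\gamma]=\mathrm{tr}\,\rho(c)$, computed in $\mathrm{SL}(3,\mathbb R)=\mathrm{PSL}(3,\mathbb R)$. Let $\mathrm{tr}_{m_\Theta}=\mathrm{tr}_\alpha\cdot\mathrm{tr}_\gamma-\mathrm{tr}_\delta$ be the trace function of the $\Theta$-web $m_\Theta$ on $P$. Corollary B. The function $\mathrm{tr}_{m_\Theta}$ is smooth on $\widehat{\mathfrak C}(P)$, and for every symplectic leaf $\mathcal Q$ of $\widehat{\mathfrak C}(P)$ the restriction $\mathrm{tr}_{m_\Theta}|_{\mathcal Q}\colon\mathcal Q\to\mathbb R$ attains a maximum, at exactly one point of $\mathcal Q$. Moreover, the Hamiltonian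 flow of $\mathrm{tr}_{m_\Theta}|_{\mathcal Q}$ on $\mathcal Q$ exists for all times and is unique, every orbit of it is periodic (a fixed point counts as a periodic orbit), and it has exactly one fixed point. -/

import Mathlib

open scoped Matrix LinearAlgebra.Projectivization ContDiff

noncomputable section

namespace Pants

/-- The group `SL(3, ℝ)`, which is the same as `PSL(3, ℝ)` because its centre is trivial. -/
abbrev SL3 : Type := Matrix.SpecialLinearGroup (Fin 3) ℝ

/-! ### Flags in the real projective plane and their invariants -/

/-- A full flag `(p, ℓ)`: a point of `ℝP²` and a projective line, given by the class of a row
vector, with `ℓ(p) = 0`. -/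
@[ext]
structure Flag where
  /-- the point of the flag -/
  point : ℙ ℝ (Fin 3 → ℝ)
  /-- the line of the flag, as the projective class of a row vector -/
  line : ℙ ℝ (Fin 3 → ℝ)
  /-- the point lies on the line -/
  incident : line.orthogonal point

theorem orthogonal_smul (g : SL3) {l p : ℙ ℝ (Fin 3 → ℝ)} (h : l.orthogonal p) :
    ((g⁻¹).transpose • l).orthogonal (g • p) := by
  induction l with | h l hl =>
  induction p with | h p hp =>
  rw [Projectivization.orthogonal_mk] at h
  rw [Projectivization.smul_mk, Projectivization.smul_mk, Projectivization.orthogonal_mk]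
  change (((g⁻¹ : SL3) : Matrix (Fin 3) (Fin 3) ℝ)ᵀ *ᵥ l) ⬝ᵥ
    ((g : Matrix (Fin 3) (Fin 3) ℝ) *ᵥ p) = 0
  rw [Matrix.mulVec_transpose, ← Matrix.dotProduct_mulVec, Matrix.mulVec_mulVec,
    ← Matrix.SpecialLinearGroup.coe_mul, inv_mul_cancel]
  simpa using h

/-- The projective action on flags: `g · (p, ℓ) = (g p, ℓ g⁻¹)`. -/
instance : MulAction SL3 Flag where
  smul g F := ⟨g • F.point, (g⁻¹).transpose • F.line, orthogonal_smul g F.incident⟩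
  one_smul F := by
    have h : ((1 : SL3)⁻¹).transpose = 1 := by
      ext i j; simp [Matrix.SpecialLinearGroup.transpose]
    refine Flag.ext (one_smul _ _) ?_
    change ((1 : SL3)⁻¹).transpose • F.line = F.line
    rw [h, one_smul]
  mul_smul g k F := by
    have h : ((g * k)⁻¹).transpose = (g⁻¹).transpose * (k⁻¹).transpose := by
      apply Subtype.ext
      simp only [mul_inv_rev, Matrix.SpecialLinearGroup.coe_transpose,
        Matrix.SpecialLinearGroup.coe_mul, Matrix.transpose_mul]
    refine Flag.ext (mul_smul _ _ _) ?_
    change ((g * k)⁻¹).transpose • F.line = (g⁻¹).transpose • (k⁻¹).transpose • F.line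
    rw [h, mul_smul]

/-- The value `ℓ(p)` on chosen representatives. -/
def ev (l p : ℙ ℝ (Fin 3 → ℝ)) : ℝ := l.rep ⬝ᵥ p.rep

/-- The value at `r` of the line through `p` and `q`, on chosen representatives; the line through
`p` and `q` is the row vector `p × q`. -/
def evLine (p q r : ℙ ℝ (Fin 3 → ℝ)) : ℝ := (p.rep ⨯₃ q.rep) ⬝ᵥ r.rep

/-- First cross ratio of four flags. Every representative occurs as often in the numerator as in
the denominator, so the value does not depend on the chosen representatives. -/
def cr₁ (F₁ F₂ F₃ F₄ : Flag) : ℝ :=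
  -((ev F₁.line F₂.point * evLine F₁.point F₃.point F₄.point) /
    (ev F₁.line F₄.point * evLine F₁.point F₃.point F₂.point))

/-- Second cross ratio of four flags. -/
def cr₂ (F₁ F₂ F₃ F₄ : Flag) : ℝ :=
  -((ev F₃.line F₄.point * evLine F₁.point F₃.point F₂.point) /
    (ev F₃.line F₂.point * evLine F₁.point F₃.point F₄.point))

/-- Triple ratio of three flags. -/
def tripleRatio (F₁ F₂ F₃ : Flag) : ℝ :=
  (ev F₁.line F₂.point * ev F₂.line F₃.point * ev F₃.line F₁.point) /
    (ev F₁.line F₃.point * ev F₂.line F₁.point * ev F₃.line F₂.point)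

theorem exists_rep_smul (g : SL3) (p : ℙ ℝ (Fin 3 → ℝ)) :
    ∃ a : ℝ, a ≠ 0 ∧ (g • p).rep = a • ((g : Matrix (Fin 3) (Fin 3) ℝ) *ᵥ p.rep) := by
  have hne : g • p.rep ≠ 0 := (smul_ne_zero_iff_ne g).mpr p.rep_nonzero
  obtain ⟨a, ha⟩ := Projectivization.exists_smul_eq_mk_rep ℝ (g • p.rep) hne
  refine ⟨a, a.ne_zero, ?_⟩
  have h : g • p = Projectivization.mk ℝ (g • p.rep) hne := by
    rw [← Projectivization.smul_mk g p.rep_nonzero, Projectivization.mk_rep]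
  rw [h, ← ha]
  rfl

/-- The projective action multiplies the evaluations on representatives by nonzero factors, one
for each point and one for each line that occurs. -/
theorem ev_scale (g : SL3) : ∃ a b : ℙ ℝ (Fin 3 → ℝ) → ℝ, (∀ p, a p ≠ 0) ∧ (∀ l, b l ≠ 0) ∧
    (∀ l p, ev ((g⁻¹).transpose • l) (g • p) = b l * a p * ev l p) ∧
    (∀ p q r, evLine (g • p) (g • q) (g • r) = a p * a q * a r * evLine p q r) := by
  choose a ha ha' using exists_rep_smul g
  choose b hb hb' using exists_rep_smul (g⁻¹).transpose
  refine ⟨a, b, ha, hb, fun l p => ?_, fun p q r => ?_⟩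
  · have h : (((g⁻¹).transpose : SL3) : Matrix (Fin 3) (Fin 3) ℝ) *ᵥ l.rep ⬝ᵥ
        ((g : Matrix (Fin 3) (Fin 3) ℝ) *ᵥ p.rep) = l.rep ⬝ᵥ p.rep := by
      rw [Matrix.SpecialLinearGroup.coe_transpose, Matrix.mulVec_transpose,
        ← Matrix.dotProduct_mulVec, Matrix.mulVec_mulVec,
        ← Matrix.SpecialLinearGroup.coe_mul, inv_mul_cancel]
      simp
    rw [ev, ha', hb', smul_dotProduct, dotProduct_smul, h, ev, smul_eq_mul, smul_eq_mul]
    ring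
  · have hdet := g.2
    rw [Matrix.det_fin_three] at hdet
    rw [evLine, ha', ha', ha', evLine]
    simp only [cross_apply, Matrix.mulVec, dotProduct, Fin.sum_univ_three, Pi.smul_apply,
      smul_eq_mul, Matrix.cons_val_zero, Matrix.cons_val_one, Matrix.cons_val]
    linear_combination (a p * a q * a r *
      ((p.rep 1 * q.rep 2 - p.rep 2 * q.rep 1) * r.rep 0 +
       (p.rep 2 * q.rep 0 - p.rep 0 * q.rep 2) * r.rep 1 +
       (p.rep 0 * q.rep 1 - p.rep 1 * q.rep 0) * r.rep 2)) * hdet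

theorem cr₁_smul (g : SL3) (F₁ F₂ F₃ F₄ : Flag) :
    cr₁ (g • F₁) (g • F₂) (g • F₃) (g • F₄) = cr₁ F₁ F₂ F₃ F₄ := by
  obtain ⟨a, b, ha, hb, h, h'⟩ := ev_scale g
  change -((ev ((g⁻¹).transpose • F₁.line) (g • F₂.point) *
      evLine (g • F₁.point) (g • F₃.point) (g • F₄.point)) /
    (ev ((g⁻¹).transpose • F₁.line) (g • F₄.point) *
      evLine (g • F₁.point) (g • F₃.point) (g • F₂.point))) = _
  have hk : b F₁.line * a F₁.point * a F₂.point * a F₃.point * a F₄.point ≠ 0 := by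
    simp [ha, hb]
  rw [h, h, h', h', cr₁, ← mul_div_mul_left (ev F₁.line F₂.point * _) _ hk]
  congr 2 <;> ring

theorem cr₂_smul (g : SL3) (F₁ F₂ F₃ F₄ : Flag) :
    cr₂ (g • F₁) (g • F₂) (g • F₃) (g • F₄) = cr₂ F₁ F₂ F₃ F₄ := by
  obtain ⟨a, b, ha, hb, h, h'⟩ := ev_scale g
  change -((ev ((g⁻¹).transpose • F₃.line) (g • F₄.point) *
      evLine (g • F₁.point) (g • F₃.point) (g • F₂.point)) /
    (ev ((g⁻¹).transpose • F₃.line) (g • F₂.point) *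
      evLine (g • F₁.point) (g • F₃.point) (g • F₄.point))) = _
  have hk : b F₃.line * a F₁.point * a F₂.point * a F₃.point * a F₄.point ≠ 0 := by
    simp [ha, hb]
  rw [h, h, h', h', cr₂, ← mul_div_mul_left (ev F₃.line F₄.point * _) _ hk]
  congr 2 <;> ring

theorem tripleRatio_smul (g : SL3) (F₁ F₂ F₃ : Flag) :
    tripleRatio (g • F₁) (g • F₂) (g • F₃) = tripleRatio F₁ F₂ F₃ := by
  obtain ⟨a, b, ha, hb, h, -⟩ := ev_scale g
  change (ev ((g⁻¹).transpose • F₁.line) (g • F₂.point) *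
      ev ((g⁻¹).transpose • F₂.line) (g • F₃.point) *
      ev ((g⁻¹).transpose • F₃.line) (g • F₁.point)) /
    (ev ((g⁻¹).transpose • F₁.line) (g • F₃.point) *
      ev ((g⁻¹).transpose • F₂.line) (g • F₁.point) *
      ev ((g⁻¹).transpose • F₃.line) (g • F₂.point)) = _
  have hk : b F₁.line * b F₂.line * b F₃.line * a F₁.point * a F₂.point * a F₃.point ≠ 0 := by
    simp [ha, hb]
  rw [h, h, h, h, h, h, tripleRatio,
    ← mul_div_mul_left (ev F₁.line F₂.point * _ * _) _ hk]
  congr 1 <;> ring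

/-! ### Framed representations of the fundamental group of the pair of pants -/

/-- The fundamental group of the pair of pants, `⟨α, β, γ | α β γ = 1⟩`, generated by the three
boundary curves. -/
abbrev PantsGroup : Type :=
  PresentedGroup ({FreeGroup.of 0 * FreeGroup.of 1 * FreeGroup.of 2} : Set (FreeGroup (Fin 3)))

/-- The boundary curve `α`. -/
def curveα : PantsGroup := PresentedGroup.of 0

/-- The boundary curve `β`. -/
def curveβ : PantsGroup := PresentedGroup.of 1

/-- The boundary curve `γ`. -/
def curveγ : PantsGroup := PresentedGroup.of 2

/-- The figure eight curve `δ = α γ⁻¹`. -/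
def curveδ : PantsGroup := curveα * curveγ⁻¹

/-- A framed representation: a representation of the fundamental group of the pair of pants
together with one invariant flag for each of the three boundary curves. -/
@[ext]
structure FramedRep where
  /-- the representation -/
  rho : PantsGroup →* SL3
  /-- the flag at the puncture of `α` -/
  flagα : Flag
  /-- the flag at the puncture of `β` -/
  flagβ : Flag
  /-- the flag at the puncture of `γ` -/
  flagγ : Flag
  fixα : rho curveα • flagα = flagα
  fixβ : rho curveβ • flagβ = flagβ
  fixγ : rho curveγ • flagγ = flagγ

theorem conj_smul_smul {g h : SL3} {F : Flag} (hF : h • F = F) :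
    (g * h * g⁻¹) • g • F = g • F := by
  rw [mul_smul, inv_smul_smul, mul_smul, hF]

/-- `SL(3, ℝ)` acts on framed representations by `g · (ρ, F) = (g ρ g⁻¹, g F)`. -/
instance : MulAction SL3 FramedRep where
  smul g R :=
    { rho := (MulAut.conj g).toMonoidHom.comp R.rho
      flagα := g • R.flagα
      flagβ := g • R.flagβ
      flagγ := g • R.flagγ
      fixα := conj_smul_smul R.fixα
      fixβ := conj_smul_smul R.fixβ
      fixγ := conj_smul_smul R.fixγ }
  one_smul R := by
    refine FramedRep.ext (MonoidHom.ext fun x => ?_) (one_smul _ _) (one_smul _ _) (one_smul _ _)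
    change (1 : SL3) * R.rho x * (1 : SL3)⁻¹ = R.rho x
    simp
  mul_smul g k R := by
    refine FramedRep.ext (MonoidHom.ext fun x => ?_) (mul_smul _ _ _) (mul_smul _ _ _)
      (mul_smul _ _ _)
    change g * k * R.rho x * (g * k)⁻¹ = g * (k * R.rho x * k⁻¹) * g⁻¹
    group

/-- The Fock–Goncharov coordinates `(σ₁, …, σ₆, τ₁, τ₂)` of a framed representation, for the
ideal triangulation of the pair of pants by two triangles, each with one vertex at every puncture.

Let `A`, `B`, `C` be the flags at the lifts `a`, `b`, `c` of the punctures that are fixed by `α`,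
`β`, `γ`. Then `a, c, b` are, in counterclockwise order, the vertices of a lift of the first
triangle, and the lifts of the second triangle adjacent to it have the additional vertices `α b`
(across the edge `ac`), `β c` (across `ab`) and `γ a` (across `cb`). The coordinates `σ₂`, `σ₁`
belong to the edge `ac`, with `σ₂` next to `a`; `σ₃`, `σ₄` to the edge `ab`, with `σ₃` next to
`a`; and `σ₆`, `σ₅` to the edge `cb`, with `σ₆` next to `c`. -/
def FramedRep.coord (R : FramedRep) : Fin 8 → ℝ :=
  let A := R.flagα
  let B := R.flagβ
  let C := R.flagγ
  let A' := R.rho curveγ • A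
  let B' := R.rho curveα • B
  let C' := R.rho curveβ • C
  ![cr₂ A B' C B, cr₁ A B' C B,
    cr₁ A C B C', cr₂ A C B C',
    cr₂ C A' B A, cr₁ C A' B A,
    tripleRatio A C B, tripleRatio A B' C]

theorem FramedRep.coord_smul (g : SL3) (R : FramedRep) : (g • R).coord = R.coord := by
  have key (h : SL3) (F : Flag) : (g * h * g⁻¹) • g • F = g • h • F := by
    rw [mul_smul, inv_smul_smul, mul_smul]
  have hA : (g • R).rho curveγ • (g • R).flagα = g • R.rho curveγ • R.flagα := key _ _
  have hB : (g • R).rho curveα • (g • R).flagβ = g • R.rho curveα • R.flagβ := key _ _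
  have hC : (g • R).rho curveβ • (g • R).flagγ = g • R.rho curveβ • R.flagγ := key _ _
  simp only [FramedRep.coord, hA, hB, hC]
  simp only [show (g • R).flagα = g • R.flagα from rfl, show (g • R).flagβ = g • R.flagβ from rfl,
    show (g • R).flagγ = g • R.flagγ from rfl, cr₁_smul, cr₂_smul, tripleRatio_smul]

/-- The trace `tr ρ(c)` of a closed curve `c`. -/
def FramedRep.trace (c : PantsGroup) (R : FramedRep) : ℝ :=
  (R.rho c : Matrix (Fin 3) (Fin 3) ℝ).trace

theorem FramedRep.trace_smul (c : PantsGroup) (g : SL3) (R : FramedRep) :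
    (g • R).trace c = R.trace c := by
  change ((g * R.rho c * g⁻¹ : SL3) : Matrix (Fin 3) (Fin 3) ℝ).trace = _
  rw [Matrix.SpecialLinearGroup.coe_mul, Matrix.trace_mul_comm,
    ← Matrix.SpecialLinearGroup.coe_mul, inv_mul_cancel_left]
  rfl

/-- Framed representations up to conjugation. -/
abbrev FramedRepSpace : Type := MulAction.orbitRel.Quotient SL3 FramedRep

/-- The Fock–Goncharov coordinates of a class of framed representations. -/
def FramedRepSpace.coord : FramedRepSpace → Fin 8 → ℝ :=
  Quotient.lift FramedRep.coord (by
    rintro _ R ⟨g, rfl⟩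
    exact R.coord_smul g)

/-- The trace function of a closed curve on classes of framed representations. -/
def FramedRepSpace.trace (c : PantsGroup) : FramedRepSpace → ℝ :=
  Quotient.lift (FramedRep.trace c) (by
    rintro _ R ⟨g, rfl⟩
    exact R.trace_smul c g)

/-- The space of framed convex projective structures on the pair of pants, realized by framed
holonomies: the space of positive framed representations up to conjugation, positivity meaning
that all Fock–Goncharov coordinates are positive. -/
def FramedConvex : Type := {x : FramedRepSpace // ∀ i, 0 < x.coord i}

/-- The Fock–Goncharov coordinates as a map to `ℝ⁸`, with values in the positive orthant. -/
def coord (q : FramedConvex) : Fin 8 → ℝ := FramedRepSpace.coord q.1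

/-- The trace function `tr_c` of a closed curve `c`. -/
def tr (c : PantsGroup) (q : FramedConvex) : ℝ := FramedRepSpace.trace c q.1

/-- The trace function of the `Θ`-web, `tr_α tr_γ - tr_δ` with `δ = α γ⁻¹`. -/
def trTheta (q : FramedConvex) : ℝ := tr curveα q * tr curveγ q - tr curveδ q

/-! ### The Poisson structure, Hamiltonian flows and symplectic leaves -/

/-- The open positive orthant of `ℝ⁸`. -/
def orthant : Set (Fin 8 → ℝ) := {x | ∀ i, 0 < x i}

/-- A function in Fock–Goncharov coordinates: the function `f ∘ coord⁻¹` on the image of `coord`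
(and `0` elsewhere). -/
def inCoord (f : FramedConvex → ℝ) : (Fin 8 → ℝ) → ℝ := Function.extend coord f 0

/-- Smooth functions on the space of framed convex projective structures. -/
def IsSmooth (f : FramedConvex → ℝ) : Prop := ContDiffOn ℝ ∞ (inCoord f) orthant

/-- The exchange matrix of the quiver of the triangulation, in the order
`σ₁, …, σ₆, τ₁, τ₂` of the vertices: the entry `(i, j)` is the number of arrows from `i` to `j`
minus the number of arrows from `j` to `i`. -/
def quiver : Matrix (Fin 8) (Fin 8) ℝ :=
  !![ 0, 0,  0, 0,  0, 0,  1, -1;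
      0, 0,  0, 0,  0, 0, -1,  1;
      0, 0,  0, 0,  0, 0,  1, -1;
      0, 0,  0, 0,  0, 0, -1,  1;
      0, 0,  0, 0,  0, 0,  1, -1;
      0, 0,  0, 0,  0, 0, -1,  1;
     -1, 1, -1, 1, -1, 1,  0,  0;
      1, -1, 1, -1, 1, -1, 0,  0]

/-- The partial derivative with respect to the `i`-th coordinate. -/
def partialDeriv (i : Fin 8) (f : FramedConvex → ℝ) (q : FramedConvex) : ℝ :=
  fderiv ℝ (inCoord f) (coord q) (Pi.single i 1)

/-- The Poisson bracket, the biderivation with `{Xᵢ, Xⱼ} = 2 εᵢⱼ Xᵢ Xⱼ` on the coordinate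
functions. -/
def bracket (f g : FramedConvex → ℝ) (q : FramedConvex) : ℝ :=
  ∑ i, ∑ j, 2 * quiver i j * coord q i * coord q j * partialDeriv i f q * partialDeriv j g q

/-- The path `c` is, over the time set `s`, an integral curve of the Hamiltonian vector field
`H_f`, which is defined by `dg(H_f) = {g, f}` for all smooth functions `g`. -/
def IsHamiltonianCurveOn (f : FramedConvex → ℝ) (c : ℝ → FramedConvex) (s : Set ℝ) : Prop :=
  ∀ g, IsSmooth g → ∀ t ∈ s, HasDerivWithinAt (fun u => g (c u)) (bracket g f (c t)) s t

/-- The time one flow of the Hamiltonian vector field of some smooth function takes `p` to `q`. -/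
def HamiltonianStep (p q : FramedConvex) : Prop :=
  ∃ f, IsSmooth f ∧ ∃ c : ℝ → FramedConvex,
    IsHamiltonianCurveOn f c (Set.Icc 0 1) ∧ c 0 = p ∧ c 1 = q

/-- A symplectic leaf: the set of all points that can be reached from some point by finitely many
time one Hamiltonian flows. -/
def IsSymplecticLeaf (Q : Set FramedConvex) : Prop :=
  ∃ p, Q = {q | Relation.ReflTransGen HamiltonianStep p q}

/-- `Φ` is the Hamiltonian flow, defined for all times, of the restriction of `f` to the leaf `Q`.
The Poisson bracket of the leaf is the restriction of the ambient one, so that the Hamiltonian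
vector field of the restriction of `f` is the restriction of `H_f`. -/
def IsHamiltonianFlow (f : FramedConvex → ℝ) (Q : Set FramedConvex) (Φ : ℝ → Q → Q) : Prop :=
  ∀ q : Q, Φ 0 q = q ∧ IsHamiltonianCurveOn f (fun t => (Φ t q : FramedConvex)) Set.univ

end Pants

end

open scoped Matrix LinearAlgebra.Projectivization ContDiff

noncomputable section

namespace Pants

/-! The Fock–Goncharov coordinates identify the space with the open orthant. They are injective
(`coord_injective`): a generic triple of flags is determined up to `SL(3, ℝ)` by its triple ratio,
the coordinates then fix the flags of the neighbouring triangles, and an element of `SL(3, ℝ)` is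
determined by its action on a generic triple. They are onto (`coord_stdRep`): explicit matrices
realize every positive vector.

In logarithmic coordinates the Poisson tensor is constant of rank two (`quiver_eq`). Hence every
symplectic leaf is an affine plane, parametrized by `leafPt x : ℂ → ℝ⁸`, and Hamiltonian dynamics on
it becomes planar dynamics with twice the standard bracket (`step_iff`, `hamField_leafPt`).

The boundary traces `tr_α` and `tr_γ` are constant on leaves. The trace of the figure eight is a sum
of twelve exponentials of linear forms with positive coefficients, and the exponents surround the
origin. Thus the function on a leaf is a constant minus a strictly convex proper function
(`thetaFn_comp_leafPt`). It has a unique maximum `z₀`, it decreases strictly along every ray from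
`z₀`, and its superlevel sets are bounded.

These facts give the dynamics. Energy conservation confines orbits to bounded sets, so the flow is
complete and unique. Away from `z₀` the radial derivative is negative, which says that the
Hamiltonian field turns counterclockwise around `z₀` with positive angular velocity, bounded below
on each level set. After a full turn an orbit meets its initial ray again, and conservation together
with strict monotonicity on the ray forces it back to its starting point (`exists_period`). The same
positivity excludes fixed points other than `z₀`. -/

/-! ### Representatives of points and lines -/

/-- The vector `v` represents the point `p` of the projective plane. -/
def IsRep (p : ℙ ℝ (Fin 3 → ℝ)) (v : Fin 3 → ℝ) : Prop := ∃ a : ℝ, a ≠ 0 ∧ p.rep = a • v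

theorem isRep_rep (p : ℙ ℝ (Fin 3 → ℝ)) : IsRep p p.rep := ⟨1, one_ne_zero, (one_smul _ _).symm⟩

theorem isRep_mk (v : Fin 3 → ℝ) (hv : v ≠ 0) : IsRep (Projectivization.mk ℝ v hv) v := by
  obtain ⟨a, ha⟩ := Projectivization.exists_smul_eq_mk_rep ℝ v hv
  exact ⟨a, a.ne_zero, ha.symm⟩

theorem IsRep.ne_zero {p : ℙ ℝ (Fin 3 → ℝ)} {v : Fin 3 → ℝ} (h : IsRep p v) : v ≠ 0 := by
  rintro rfl
  obtain ⟨a, -, ha⟩ := h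
  exact p.rep_nonzero (by simpa using ha)

theorem IsRep.mk_eq {p : ℙ ℝ (Fin 3 → ℝ)} {v : Fin 3 → ℝ} (h : IsRep p v) :
    Projectivization.mk ℝ v h.ne_zero = p := by
  obtain ⟨a, ha, hp⟩ := h
  conv_rhs => rw [← p.mk_rep]
  rw [Projectivization.mk_eq_mk_iff']
  exact ⟨a⁻¹, by rw [hp, smul_smul, inv_mul_cancel₀ ha, one_smul]⟩

theorem IsRep.unique {p q : ℙ ℝ (Fin 3 → ℝ)} {v : Fin 3 → ℝ} (hp : IsRep p v) (hq : IsRep q v) :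
    p = q := by
  rw [← hp.mk_eq, ← hq.mk_eq]

theorem IsRep.exists_eq_smul {p : ℙ ℝ (Fin 3 → ℝ)} {v w : Fin 3 → ℝ} (hv : IsRep p v)
    (hw : IsRep p w) : ∃ a : ℝ, a ≠ 0 ∧ v = a • w := by
  obtain ⟨a, ha, h⟩ := hv
  obtain ⟨b, hb, h'⟩ := hw
  refine ⟨a⁻¹ * b, by simp [ha, hb], ?_⟩
  rw [mul_smul, ← h', h, smul_smul, inv_mul_cancel₀ ha, one_smul]

theorem IsRep.of_eq_smul {p : ℙ ℝ (Fin 3 → ℝ)} {v w : Fin 3 → ℝ} (hv : IsRep p v) {a : ℝ}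
    (ha : a ≠ 0) (h : v = a • w) : IsRep p w := by
  obtain ⟨b, hb, h'⟩ := hv
  exact ⟨b * a, mul_ne_zero hb ha, by rw [h', h, smul_smul]⟩

theorem IsRep.act (g : SL3) {p : ℙ ℝ (Fin 3 → ℝ)} {v : Fin 3 → ℝ} (h : IsRep p v) :
    IsRep (g • p) ((g : Matrix (Fin 3) (Fin 3) ℝ) *ᵥ v) := by
  obtain ⟨a, ha, hg⟩ := exists_rep_smul g p
  obtain ⟨b, hb, h'⟩ := h
  exact ⟨a * b, mul_ne_zero ha hb, by rw [hg, h', Matrix.mulVec_smul, smul_smul]⟩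

theorem Flag.rep_incident (F : Flag) : F.line.rep ⬝ᵥ F.point.rep = 0 := by
  have h := F.incident
  rw [← F.line.mk_rep, ← F.point.mk_rep, Projectivization.orthogonal_mk] at h
  exact h

/-- The flag with the given representatives. -/
def Flag.ofVec (p l : Fin 3 → ℝ) (hp : p ≠ 0) (hl : l ≠ 0) (h : l ⬝ᵥ p = 0) : Flag where
  point := Projectivization.mk ℝ p hp
  line := Projectivization.mk ℝ l hl
  incident := (Projectivization.orthogonal_mk hl hp).mpr h

/-- The vectors `p` and `l` represent the point and the line of the flag `F`. -/
structure Flag.Rep (F : Flag) (p l : Fin 3 → ℝ) : Prop where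
  point : IsRep F.point p
  line : IsRep F.line l

theorem Flag.rep_ofVec {p l : Fin 3 → ℝ} (hp : p ≠ 0) (hl : l ≠ 0) (h : l ⬝ᵥ p = 0) :
    (Flag.ofVec p l hp hl h).Rep p l := ⟨isRep_mk p hp, isRep_mk l hl⟩

theorem Flag.rep_rep (F : Flag) : F.Rep F.point.rep F.line.rep := ⟨isRep_rep _, isRep_rep _⟩

/-- Pulling the target line back by `g`, instead of pushing the source line forward, keeps the
inverse matrix out of all later computations. -/
theorem Flag.smul_eq_iff (g : SL3) {F F' : Flag} {p l p' l' : Fin 3 → ℝ} (h : F.Rep p l)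
    (h' : F'.Rep p' l') : g • F = F' ↔ ∃ a b : ℝ, a ≠ 0 ∧ b ≠ 0 ∧
      (g : Matrix (Fin 3) (Fin 3) ℝ) *ᵥ p = a • p' ∧
      l' ᵥ* (g : Matrix (Fin 3) (Fin 3) ℝ) = b • l := by
  have hp := h.point.act g
  have hl := h.line.act (g⁻¹).transpose
  have hinv : ((g⁻¹ : SL3) : Matrix (Fin 3) (Fin 3) ℝ) * (g : Matrix (Fin 3) (Fin 3) ℝ) = 1 := by
    rw [← Matrix.SpecialLinearGroup.coe_mul, inv_mul_cancel, Matrix.SpecialLinearGroup.coe_one]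
  have hinv' : (g : Matrix (Fin 3) (Fin 3) ℝ) * ((g⁻¹ : SL3) : Matrix (Fin 3) (Fin 3) ℝ) = 1 := by
    rw [← Matrix.SpecialLinearGroup.coe_mul, mul_inv_cancel, Matrix.SpecialLinearGroup.coe_one]
  rw [Matrix.SpecialLinearGroup.coe_transpose, Matrix.mulVec_transpose] at hl
  constructor
  · rintro rfl
    obtain ⟨a, ha, hap⟩ := hp.exists_eq_smul h'.point
    obtain ⟨b, hb, hbl⟩ := hl.exists_eq_smul h'.line
    refine ⟨a, b⁻¹, ha, inv_ne_zero hb, hap, ?_⟩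
    have : l' = b⁻¹ • (l ᵥ* ((g⁻¹ : SL3) : Matrix (Fin 3) (Fin 3) ℝ)) := by
      rw [hbl, smul_smul, inv_mul_cancel₀ hb, one_smul]
    rw [this, Matrix.smul_vecMul, Matrix.vecMul_vecMul, hinv, Matrix.vecMul_one]
  · rintro ⟨a, b, ha, hb, hap, hbl⟩
    refine Flag.ext ((hp.of_eq_smul ha hap).unique h'.point) (IsRep.unique (v := l') ?_ h'.line)
    refine hl.of_eq_smul (inv_ne_zero hb) ?_
    have : l = b⁻¹ • (l' ᵥ* (g : Matrix (Fin 3) (Fin 3) ℝ)) := by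
      rw [hbl, smul_smul, inv_mul_cancel₀ hb, one_smul]
    conv_lhs => rw [this]
    rw [Matrix.smul_vecMul, Matrix.vecMul_vecMul, hinv', Matrix.vecMul_one]

theorem cr₁_eq {F₁ F₂ F₃ F₄ : Flag} {p₁ l₁ p₂ p₃ p₄ : Fin 3 → ℝ} (h₁ : F₁.Rep p₁ l₁)
    (h₂ : IsRep F₂.point p₂) (h₃ : IsRep F₃.point p₃) (h₄ : IsRep F₄.point p₄) :
    cr₁ F₁ F₂ F₃ F₄ =
      -(((l₁ ⬝ᵥ p₂) * ((p₁ ⨯₃ p₃) ⬝ᵥ p₄)) / ((l₁ ⬝ᵥ p₄) * ((p₁ ⨯₃ p₃) ⬝ᵥ p₂))) := by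
  obtain ⟨⟨a₁, ha₁, e₁⟩, b₁, hb₁, e₁'⟩ := h₁
  obtain ⟨a₂, ha₂, e₂⟩ := h₂
  obtain ⟨a₃, ha₃, e₃⟩ := h₃
  obtain ⟨a₄, ha₄, e₄⟩ := h₄
  have hk : b₁ * a₁ * a₂ * a₃ * a₄ ≠ 0 := by simp [ha₁, ha₂, ha₃, ha₄, hb₁]
  rw [← mul_div_mul_left ((l₁ ⬝ᵥ p₂) * _) _ hk]
  simp only [cr₁, ev, evLine, e₁, e₂, e₃, e₄, e₁', smul_dotProduct, dotProduct_smul, smul_eq_mul,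
    map_smul, LinearMap.smul_apply]
  congr 2 <;> ring

/-- Exchanging the two points that span the line changes a sign once in the numerator and once in
the denominator. -/
theorem cr₂_eq_cr₁ (F₁ F₂ F₃ F₄ : Flag) : cr₂ F₁ F₂ F₃ F₄ = cr₁ F₃ F₄ F₁ F₂ := by
  have (a b c : ℙ ℝ (Fin 3 → ℝ)) : evLine a b c = -evLine b a c := by
    rw [evLine, evLine, ← cross_anticomm, neg_dotProduct]
  rw [cr₂, cr₁, this F₁.point, this F₁.point, mul_neg, mul_neg, neg_div_neg_eq]

theorem tripleRatio_eq {F₁ F₂ F₃ : Flag} {p₁ l₁ p₂ l₂ p₃ l₃ : Fin 3 → ℝ} (h₁ : F₁.Rep p₁ l₁)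
    (h₂ : F₂.Rep p₂ l₂) (h₃ : F₃.Rep p₃ l₃) :
    tripleRatio F₁ F₂ F₃ = ((l₁ ⬝ᵥ p₂) * (l₂ ⬝ᵥ p₃) * (l₃ ⬝ᵥ p₁)) /
      ((l₁ ⬝ᵥ p₃) * (l₂ ⬝ᵥ p₁) * (l₃ ⬝ᵥ p₂)) := by
  obtain ⟨⟨a₁, ha₁, e₁⟩, b₁, hb₁, e₁'⟩ := h₁
  obtain ⟨⟨a₂, ha₂, e₂⟩, b₂, hb₂, e₂'⟩ := h₂
  obtain ⟨⟨a₃, ha₃, e₃⟩, b₃, hb₃, e₃'⟩ := h₃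
  have hk : b₁ * b₂ * b₃ * a₁ * a₂ * a₃ ≠ 0 := by simp [ha₁, ha₂, ha₃, hb₁, hb₂, hb₃]
  rw [← mul_div_mul_left ((l₁ ⬝ᵥ p₂) * _ * _) _ hk]
  simp only [tripleRatio, ev, e₁, e₂, e₃, e₁', e₂', e₃', smul_dotProduct, dotProduct_smul,
    smul_eq_mul]
  congr 1 <;> ring

/-! ### Generic triples of flags -/

theorem det_of_vec3 (u v w : Fin 3 → ℝ) : (Matrix.of ![u, v, w]).det = (u ⨯₃ v) ⬝ᵥ w := by
  simp [Matrix.det_fin_three, cross_apply, dotProduct, Fin.sum_univ_three]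
  ring

theorem eq_of_dotProduct_eq {u v w x y : Fin 3 → ℝ} (h : (u ⨯₃ v) ⬝ᵥ w ≠ 0)
    (hu : u ⬝ᵥ x = u ⬝ᵥ y) (hv : v ⬝ᵥ x = v ⬝ᵥ y) (hw : w ⬝ᵥ x = w ⬝ᵥ y) : x = y := by
  rw [← det_of_vec3] at h
  rw [← sub_eq_zero]
  apply Matrix.eq_zero_of_mulVec_eq_zero h
  ext i
  fin_cases i <;> simp [Matrix.mulVec, dotProduct_sub, hu, hv, hw]

/-- Three flags in general position: no point lies on the line of another flag, and the points
are not collinear. -/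
structure Generic (F₁ F₂ F₃ : Flag) : Prop where
  h₁₂ : ev F₁.line F₂.point ≠ 0
  h₁₃ : ev F₁.line F₃.point ≠ 0
  h₂₁ : ev F₂.line F₁.point ≠ 0
  h₂₃ : ev F₂.line F₃.point ≠ 0
  h₃₁ : ev F₃.line F₁.point ≠ 0
  h₃₂ : ev F₃.line F₂.point ≠ 0
  h : evLine F₁.point F₂.point F₃.point ≠ 0

/-- Since division by zero gives zero, a nonzero triple ratio makes the three factors of its
denominator nonzero as well as those of its numerator. -/
theorem generic_of_tripleRatio_ne_zero {F₁ F₂ F₃ : Flag} (h : tripleRatio F₁ F₂ F₃ ≠ 0)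
    (h' : evLine F₁.point F₂.point F₃.point ≠ 0) : Generic F₁ F₂ F₃ := by
  simp only [tripleRatio, ne_eq, div_eq_zero_iff, mul_eq_zero, not_or] at h
  constructor <;> tauto

/-- A fixed point and a fixed line that misses it have the same eigenvalue. Genericity links the
three points through the lines, so all eigenvalues agree, `g` is scalar, and 1 is the only real cube
root of 1. -/
theorem eq_one_of_smul_eq {F₁ F₂ F₃ : Flag} (h : Generic F₁ F₂ F₃) {g : SL3} (h₁ : g • F₁ = F₁)
    (h₂ : g • F₂ = F₂) (h₃ : g • F₃ = F₃) : g = 1 := by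
  rw [Flag.smul_eq_iff g F₁.rep_rep F₁.rep_rep] at h₁
  rw [Flag.smul_eq_iff g F₂.rep_rep F₂.rep_rep] at h₂
  rw [Flag.smul_eq_iff g F₃.rep_rep F₃.rep_rep] at h₃
  obtain ⟨a₁, b₁, -, -, e₁, f₁⟩ := h₁
  obtain ⟨a₂, b₂, -, -, e₂, f₂⟩ := h₂
  obtain ⟨a₃, b₃, -, -, e₃, f₃⟩ := h₃
  have key {F F' : Flag} {a b : ℝ} (hne : ev F.line F'.point ≠ 0)
      (e : (g : Matrix (Fin 3) (Fin 3) ℝ) *ᵥ F'.point.rep = a • F'.point.rep)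
      (f : F.line.rep ᵥ* (g : Matrix (Fin 3) (Fin 3) ℝ) = b • F.line.rep) : a = b := by
    have := Matrix.dotProduct_mulVec F.line.rep (g : Matrix (Fin 3) (Fin 3) ℝ) F'.point.rep
    rw [e, f, dotProduct_smul, smul_dotProduct] at this
    exact mul_right_cancel₀ hne this
  have k₁ := key h.h₂₁ e₁ f₂
  have k₂ := key h.h₃₂ e₂ f₃
  have k₃ := key h.h₂₃ e₃ f₂
  have k₄ := key h.h₃₁ e₁ f₃
  have h12 : a₂ = a₁ := by rw [k₂, k₄]
  have h13 : a₃ = a₁ := by rw [k₃, k₁]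
  rw [h12] at e₂
  rw [h13] at e₃
  have hdet := h.h
  rw [evLine, ← det_of_vec3] at hdet
  set P : Matrix (Fin 3) (Fin 3) ℝ :=
    Matrix.of ![F₁.point.rep, F₂.point.rep, F₃.point.rep] with hP
  have hPg : P * (g : Matrix (Fin 3) (Fin 3) ℝ)ᵀ = P * a₁ • (1 : Matrix (Fin 3) (Fin 3) ℝ) := by
    ext i j
    rw [Matrix.mul_smul, Matrix.mul_one, Matrix.smul_apply, smul_eq_mul]
    fin_cases i
    · have := congrFun e₁ j
      simpa [P, Matrix.mul_apply, Matrix.mulVec, dotProduct, Matrix.transpose_apply, mul_comm]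
        using this
    · have := congrFun e₂ j
      simpa [P, Matrix.mul_apply, Matrix.mulVec, dotProduct, Matrix.transpose_apply, mul_comm]
        using this
    · have := congrFun e₃ j
      simpa [P, Matrix.mul_apply, Matrix.mulVec, dotProduct, Matrix.transpose_apply, mul_comm]
        using this
  have hg : (g : Matrix (Fin 3) (Fin 3) ℝ)ᵀ = a₁ • (1 : Matrix (Fin 3) (Fin 3) ℝ) :=
    ((Matrix.isUnit_iff_isUnit_det P).mpr hdet.isUnit).mul_left_cancel hPg
  have hd : a₁ ^ 3 = 1 := by
    have := congrArg Matrix.det hg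
    rw [Matrix.det_transpose, g.2] at this
    simpa using this.symm
  have ha : a₁ = 1 := by
    have : (a₁ - 1) * (a₁ ^ 2 + a₁ + 1) = 0 := by linear_combination hd
    rcases mul_eq_zero.mp this with h | h <;> nlinarith [sq_nonneg (a₁ + 1)]
  apply Subtype.ext
  rw [← Matrix.transpose_transpose (g : Matrix (Fin 3) (Fin 3) ℝ), hg, ha, one_smul,
    Matrix.transpose_one]
  rfl

theorem exists_pow_three_eq (d : ℝ) : ∃ k : ℝ, k ^ 3 = d := by
  have key {d : ℝ} (hd : 0 ≤ d) : ∃ k : ℝ, k ^ 3 = d :=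
    ⟨d ^ (1 / 3 : ℝ), by rw [← Real.rpow_natCast, ← Real.rpow_mul hd]; norm_num⟩
  rcases le_total 0 d with hd | hd
  · exact key hd
  · obtain ⟨k, hk⟩ := key (neg_nonneg.mpr hd)
    exact ⟨-k, by linear_combination -hk⟩

/-- Rescaling an invertible matrix to determinant one. -/
theorem exists_SL3_eq_smul {M : Matrix (Fin 3) (Fin 3) ℝ} (hM : M.det ≠ 0) :
    ∃ (k : ℝ) (g : SL3), k ≠ 0 ∧ (g : Matrix (Fin 3) (Fin 3) ℝ) = k • M := by
  obtain ⟨k, hk⟩ := exists_pow_three_eq M.det⁻¹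
  refine ⟨k, ⟨k • M, ?_⟩, ?_, rfl⟩
  · rw [Matrix.det_smul, Fintype.card_fin, hk, inv_mul_cancel₀ hM]
  · rintro rfl
    exact inv_ne_zero hM (by simpa using hk.symm)

/-- Maps that match the three points form a two-parameter family up to scalars. Matching the first
two lines uses up both parameters, and the condition on the third line is then exactly equality of
triple ratios. -/
theorem exists_smul_eq_of_tripleRatio_eq {F₁ F₂ F₃ G₁ G₂ G₃ : Flag} (hF : Generic F₁ F₂ F₃)
    (hG : Generic G₁ G₂ G₃) (h : tripleRatio F₁ F₂ F₃ = tripleRatio G₁ G₂ G₃) :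
    ∃ g : SL3, g • F₁ = G₁ ∧ g • F₂ = G₂ ∧ g • F₃ = G₃ := by
  have hP := hF.h
  have hQ := hG.h
  rw [evLine, ← det_of_vec3] at hP hQ
  set P : Matrix (Fin 3) (Fin 3) ℝ :=
    Matrix.of ![F₁.point.rep, F₂.point.rep, F₃.point.rep] with hPdef
  set Q : Matrix (Fin 3) (Fin 3) ℝ :=
    Matrix.of ![G₁.point.rep, G₂.point.rep, G₃.point.rep] with hQdef
  have hPu : IsUnit P.det := hP.isUnit
  obtain ⟨hF₁₂, hF₁₃, hF₂₁, hF₂₃, hF₃₁, hF₃₂, hF'⟩ := hF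
  obtain ⟨hG₁₂, hG₁₃, hG₂₁, hG₂₃, hG₃₁, hG₃₂, -⟩ := hG
  -- The weight `t₁` is forced by the second line and `t₂` by the first; the weight of the third
  -- point is normalized to 1.
  set t₁ : ℝ := (ev G₂.line G₃.point / ev F₂.line F₃.point) /
    (ev G₂.line G₁.point / ev F₂.line F₁.point) with ht₁
  set t₂ : ℝ := (ev G₁.line G₃.point / ev F₁.line F₃.point) /
    (ev G₁.line G₂.point / ev F₁.line F₂.point) with ht₂
  have ht₁' : t₁ ≠ 0 := by simp [*]
  have ht₂' : t₂ ≠ 0 := by simp [*]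
  have hD : (P⁻¹ * Matrix.diagonal ![t₁, t₂, 1] * Q)ᵀ.det ≠ 0 := by
    rw [Matrix.det_transpose, Matrix.det_mul, Matrix.det_mul, Matrix.det_diagonal,
      Fin.prod_univ_three, Matrix.det_nonsing_inv, Ring.inverse_eq_inv']
    simp [hP, hQ, ht₁', ht₂']
  obtain ⟨k, g, hk, hg⟩ := exists_SL3_eq_smul hD
  have hPg : P * (g : Matrix (Fin 3) (Fin 3) ℝ)ᵀ = k • (Matrix.diagonal ![t₁, t₂, 1] * Q) := by
    rw [hg, Matrix.transpose_smul, Matrix.transpose_transpose, Matrix.mul_smul, mul_assoc,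
      ← mul_assoc, Matrix.mul_nonsing_inv _ hPu, one_mul]
  have hrow (i : Fin 3) : (g : Matrix (Fin 3) (Fin 3) ℝ) *ᵥ (P i) = (k * ![t₁, t₂, 1] i) • Q i := by
    ext j
    have := congrFun (congrFun hPg i) j
    rw [Matrix.smul_apply, Matrix.diagonal_mul] at this
    simp only [Matrix.mul_apply, Matrix.transpose_apply] at this
    simp only [Matrix.mulVec, dotProduct, Pi.smul_apply, smul_eq_mul]
    rw [mul_assoc, ← smul_eq_mul k, ← this]
    exact Finset.sum_congr rfl fun x _ => mul_comm _ _
  have e₁ : (g : Matrix (Fin 3) (Fin 3) ℝ) *ᵥ F₁.point.rep = (k * t₁) • G₁.point.rep := hrow 0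
  have e₂ : (g : Matrix (Fin 3) (Fin 3) ℝ) *ᵥ F₂.point.rep = (k * t₂) • G₂.point.rep := hrow 1
  have e₃ : (g : Matrix (Fin 3) (Fin 3) ℝ) *ᵥ F₃.point.rep = (k * 1) • G₃.point.rep := hrow 2
  have h0F₁ := F₁.rep_incident
  have h0F₂ := F₂.rep_incident
  have h0F₃ := F₃.rep_incident
  have h0G₁ := G₁.rep_incident
  have h0G₂ := G₂.rep_incident
  have h0G₃ := G₃.rep_incident
  have line {F G : Flag} {b : ℝ}
      (c₁ : (k * t₁) * (G.line.rep ⬝ᵥ G₁.point.rep) = b * (F.line.rep ⬝ᵥ F₁.point.rep))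
      (c₂ : (k * t₂) * (G.line.rep ⬝ᵥ G₂.point.rep) = b * (F.line.rep ⬝ᵥ F₂.point.rep))
      (c₃ : (k * 1) * (G.line.rep ⬝ᵥ G₃.point.rep) = b * (F.line.rep ⬝ᵥ F₃.point.rep)) :
      G.line.rep ᵥ* (g : Matrix (Fin 3) (Fin 3) ℝ) = b • F.line.rep := by
    refine eq_of_dotProduct_eq hF' ?_ ?_ ?_ <;>
      rw [dotProduct_comm, ← Matrix.dotProduct_mulVec, dotProduct_smul,
        dotProduct_comm _ F.line.rep, smul_eq_mul]
    · rw [e₁, dotProduct_smul, smul_eq_mul, c₁]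
    · rw [e₂, dotProduct_smul, smul_eq_mul, c₂]
    · rw [e₃, dotProduct_smul, smul_eq_mul, c₃]
  simp only [tripleRatio] at h
  rw [div_eq_div_iff (by simp [*]) (by simp [*])] at h
  simp only [ev] at *
  refine ⟨g, ?_, ?_, ?_⟩
  · rw [Flag.smul_eq_iff g F₁.rep_rep G₁.rep_rep]
    refine ⟨_, k * ((G₁.line.rep ⬝ᵥ G₃.point.rep) / (F₁.line.rep ⬝ᵥ F₃.point.rep)),
      mul_ne_zero hk ht₁', by simp [*], e₁, line ?_ ?_ ?_⟩
    · rw [h0F₁, h0G₁, mul_zero, mul_zero]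
    · rw [ht₂]; field_simp
    · field_simp
  · rw [Flag.smul_eq_iff g F₂.rep_rep G₂.rep_rep]
    refine ⟨_, k * ((G₂.line.rep ⬝ᵥ G₃.point.rep) / (F₂.line.rep ⬝ᵥ F₃.point.rep)),
      mul_ne_zero hk ht₂', by simp [*], e₂, line ?_ ?_ ?_⟩
    · rw [ht₁]; field_simp
    · rw [h0F₂, h0G₂, mul_zero, mul_zero]
    · field_simp
  · rw [Flag.smul_eq_iff g F₃.rep_rep G₃.rep_rep]
    refine ⟨_, k * t₁ * ((G₃.line.rep ⬝ᵥ G₁.point.rep) / (F₃.line.rep ⬝ᵥ F₁.point.rep)),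
      mul_ne_zero hk one_ne_zero, ?_, e₃, line ?_ ?_ ?_⟩
    · exact mul_ne_zero (mul_ne_zero hk ht₁') (div_ne_zero hG₃₁ hF₃₁)
    · field_simp
    · rw [ht₁, ht₂]
      field_simp
      linear_combination h
    · rw [h0F₃, h0G₃, mul_zero, mul_zero]

/-- A flag is determined by its position with respect to two flags and a third point. -/
theorem Flag.eq_of_invariants_eq {A B C F G : Flag} (hAC : ev A.line C.point ≠ 0)
    (hCA : ev C.line A.point ≠ 0) (h₁ : cr₁ A F C B = cr₁ A G C B) (h₁' : cr₁ A F C B ≠ 0)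
    (h₂ : cr₂ A F C B = cr₂ A G C B) (h₂' : cr₂ A F C B ≠ 0)
    (h₃ : tripleRatio A F C = tripleRatio A G C) (h₃' : tripleRatio A F C ≠ 0) : F = G := by
  have g₁ := h₁' ∘ h₁.trans
  have g₂ := h₂' ∘ h₂.trans
  have g₃ := h₃' ∘ h₃.trans
  have hA0 := A.rep_incident
  have hC0 := C.rep_incident
  have hF0 := F.rep_incident
  have hG0 := G.rep_incident
  simp only [cr₁, cr₂, tripleRatio, ne_eq, neg_eq_zero, div_eq_zero_iff,
    mul_eq_zero, not_or, imp_false] at h₁' h₂' h₃' g₁ g₂ g₃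
  obtain ⟨⟨x₁, x₂⟩, x₃, x₄⟩ := h₁'
  obtain ⟨⟨y₁, y₂⟩, y₃, y₄⟩ := h₂'
  obtain ⟨⟨⟨z₁, z₂⟩, z₃⟩, ⟨z₄, z₅⟩, z₆⟩ := h₃'
  obtain ⟨⟨u₁, u₂⟩, u₃, u₄⟩ := g₁
  obtain ⟨⟨v₁, v₂⟩, v₃, v₄⟩ := g₂
  obtain ⟨⟨⟨w₁, w₂⟩, w₃⟩, ⟨w₄, w₅⟩, w₆⟩ := g₃
  -- The lines of `A` and `C` and the line joining their points are independent functionals. The two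
  -- cross ratios fix the ratios of their values at the point of `F`; the triple ratio then fixes
  -- the line through that point.
  have hdet : (A.line.rep ⨯₃ C.line.rep) ⬝ᵥ (A.point.rep ⨯₃ C.point.rep) ≠ 0 := by
    rw [cross_dot_cross, hA0]
    simpa using ⟨hAC, hCA⟩
  rw [cr₁, cr₁, neg_inj, div_eq_div_iff (by simp [*]) (by simp [*])] at h₁
  rw [cr₂, cr₂, neg_inj, div_eq_div_iff (by simp [*]) (by simp [*])] at h₂
  rw [tripleRatio, tripleRatio, div_eq_div_iff (by simp [*]) (by simp [*])] at h₃
  simp only [ev, evLine] at *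
  have hp : G.point.rep = (((A.point.rep ⨯₃ C.point.rep) ⬝ᵥ G.point.rep) /
      ((A.point.rep ⨯₃ C.point.rep) ⬝ᵥ F.point.rep)) • F.point.rep := by
    refine eq_of_dotProduct_eq hdet ?_ ?_ ?_ <;> rw [dotProduct_smul, smul_eq_mul]
    · field_simp
      refine mul_left_cancel₀ (mul_ne_zero x₂ x₃) ?_
      linear_combination -h₁
    · field_simp
      refine mul_left_cancel₀ (mul_ne_zero y₁ y₄) ?_
      linear_combination h₂
    · field_simp
  have hl : G.line.rep = ((G.line.rep ⬝ᵥ A.point.rep) / (F.line.rep ⬝ᵥ A.point.rep)) •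
      F.line.rep := by
    have hFG : F.point.rep ⬝ᵥ G.line.rep = 0 := by
      rw [hp, dotProduct_smul, smul_eq_mul, mul_eq_zero] at hG0
      rw [dotProduct_comm]
      exact hG0.resolve_left (div_ne_zero u₄ x₄)
    refine eq_of_dotProduct_eq x₄ ?_ ?_ ?_ <;> rw [dotProduct_smul, smul_eq_mul]
    · rw [dotProduct_comm, dotProduct_comm _ F.line.rep]
      field_simp
    · rw [dotProduct_comm, dotProduct_comm _ F.line.rep]
      field_simp
      have e₁ : (A.line.rep ⬝ᵥ G.point.rep) = (((A.point.rep ⨯₃ C.point.rep) ⬝ᵥ G.point.rep) /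
        ((A.point.rep ⨯₃ C.point.rep) ⬝ᵥ F.point.rep)) * (A.line.rep ⬝ᵥ F.point.rep) := by
        rw [← smul_eq_mul, ← dotProduct_smul, ← hp]
      have e₂ : (C.line.rep ⬝ᵥ G.point.rep) = (((A.point.rep ⨯₃ C.point.rep) ⬝ᵥ G.point.rep) /
        ((A.point.rep ⨯₃ C.point.rep) ⬝ᵥ F.point.rep)) * (C.line.rep ⬝ᵥ F.point.rep) := by
        rw [← smul_eq_mul, ← dotProduct_smul, ← hp]
      rw [e₁, e₂] at h₃
      have hk := div_ne_zero u₄ x₄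
      refine mul_left_cancel₀ (mul_ne_zero (mul_ne_zero hk z₁)
        (mul_ne_zero z₃ (mul_ne_zero z₄ z₆))) ?_
      linear_combination -h₃
    · rw [hFG, dotProduct_comm _ F.line.rep, hF0, mul_zero]
  exact Flag.ext (((isRep_rep _).of_eq_smul (div_ne_zero u₄ x₄) hp).unique (isRep_rep _)).symm
    (((isRep_rep _).of_eq_smul (div_ne_zero w₅ z₅) hl).unique (isRep_rep _)).symm

/-! ### The coordinates separate points -/

theorem curve_relation : curveα * curveβ * curveγ = 1 := by
  have h : (PresentedGroup.mk {FreeGroup.of 0 * FreeGroup.of 1 * FreeGroup.of 2})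
      (FreeGroup.of (0 : Fin 3) * FreeGroup.of 1 * FreeGroup.of 2) = 1 :=
    PresentedGroup.one_of_mem (Set.mem_singleton _)
  rw [map_mul, map_mul] at h
  exact h

theorem FramedRep.rho_relation (R : FramedRep) :
    R.rho curveα * R.rho curveβ * R.rho curveγ = 1 := by
  rw [← map_mul, ← map_mul, curve_relation, map_one]

theorem FramedRep.smul_flagβ' (R : FramedRep) :
    R.rho curveγ • R.rho curveα • R.flagβ = R.flagβ := by
  have h : R.rho curveγ * R.rho curveα = (R.rho curveβ)⁻¹ := by
    have := R.rho_relation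
    rw [mul_eq_one_iff_eq_inv] at this
    rw [eq_inv_iff_mul_eq_one, mul_assoc, this, mul_inv_cancel]
  rw [← mul_smul, h, inv_smul_eq_iff, R.fixβ]

theorem FramedRep.smul_flagγ' (R : FramedRep) :
    R.rho curveα • R.rho curveβ • R.flagγ = R.flagγ := by
  have h : R.rho curveα * R.rho curveβ = (R.rho curveγ)⁻¹ := by
    rw [← mul_eq_one_iff_eq_inv, R.rho_relation]
  rw [← mul_smul, h, inv_smul_eq_iff, R.fixγ]

theorem cr₁_swap (F₁ F₂ F₃ F₄ : Flag) : cr₁ F₁ F₄ F₃ F₂ = (cr₁ F₁ F₂ F₃ F₄)⁻¹ := by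
  rw [cr₁, cr₁, inv_neg, inv_div]

theorem cr₂_swap (F₁ F₂ F₃ F₄ : Flag) : cr₂ F₁ F₄ F₃ F₂ = (cr₂ F₁ F₂ F₃ F₄)⁻¹ := by
  rw [cr₂, cr₂, inv_neg, inv_div]

theorem tripleRatio_rotate (F₁ F₂ F₃ : Flag) : tripleRatio F₂ F₃ F₁ = tripleRatio F₁ F₂ F₃ := by
  rw [tripleRatio, tripleRatio]; congr 1 <;> ring

theorem tripleRatio_swap (F₁ F₂ F₃ : Flag) :
    tripleRatio F₁ F₃ F₂ = (tripleRatio F₁ F₂ F₃)⁻¹ := by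
  rw [tripleRatio, tripleRatio, inv_div]; congr 1 <;> ring

theorem evLine_rotate (a b c : ℙ ℝ (Fin 3 → ℝ)) : evLine b c a = evLine a b c := by
  rw [evLine, evLine, dotProduct_comm, dotProduct_comm _ c.rep, triple_product_permutation,
    triple_product_permutation]

theorem evLine_swap (a b c : ℙ ℝ (Fin 3 → ℝ)) : evLine b a c = -evLine a b c := by
  rw [evLine, evLine, ← cross_anticomm, neg_dotProduct]

/-- The triple ratio of the second triangle of the triangulation, seen from its other two lifts. -/
theorem FramedRep.tripleRatio_flagγ' (R : FramedRep) :
    tripleRatio R.flagα (R.rho curveβ • R.flagγ) R.flagβ =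
      (tripleRatio R.flagα (R.rho curveα • R.flagβ) R.flagγ)⁻¹ := by
  have := tripleRatio_smul (R.rho curveα) R.flagα R.flagβ (R.rho curveβ • R.flagγ)
  rw [R.fixα, R.smul_flagγ'] at this
  rw [tripleRatio_swap, this]

theorem FramedRep.tripleRatio_flagα' (R : FramedRep) :
    tripleRatio R.flagγ (R.rho curveγ • R.flagα) R.flagβ =
      tripleRatio R.flagα (R.rho curveα • R.flagβ) R.flagγ := by
  have := tripleRatio_smul (R.rho curveγ) R.flagα (R.rho curveα • R.flagβ) R.flagγ
  rw [R.fixγ, R.smul_flagβ'] at this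
  rw [← this, tripleRatio_rotate, tripleRatio_rotate]

theorem FramedRep.generic_of_coord_pos {R : FramedRep} (h : ∀ i, 0 < R.coord i) :
    Generic R.flagα R.flagγ R.flagβ := by
  refine generic_of_tripleRatio_ne_zero (h 6).ne' fun h0 => (h 1).ne' ?_
  change cr₁ _ _ _ _ = 0
  -- Collinear points would make the numerator of this cross ratio vanish.
  simp [cr₁, h0]

theorem FramedRep.generic_of_coord_pos' {R : FramedRep} (h : ∀ i, 0 < R.coord i) :
    Generic R.flagα (R.rho curveα • R.flagβ) R.flagγ := by
  refine generic_of_tripleRatio_ne_zero (h 7).ne' fun h0 => (h 1).ne' ?_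
  change cr₁ _ _ _ _ = 0
  rw [← evLine_rotate, evLine_rotate, evLine_rotate, ← neg_eq_zero, ← evLine_swap,
    evLine_rotate, evLine_rotate] at h0
  -- Here the collinearity would put a zero in the denominator, and the quotient would be zero by
  -- convention.
  simp [cr₁, h0, ← evLine_rotate R.flagα.point]

theorem FramedRep.rho_eq {R S : FramedRep} (hα : R.rho curveα = S.rho curveα)
    (hγ : R.rho curveγ = S.rho curveγ) : R.rho = S.rho := by
  have hβ : R.rho curveβ = S.rho curveβ := by
    have h := R.rho_relation.trans S.rho_relation.symm
    rwa [hα, hγ, mul_left_inj, mul_right_inj] at h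
  refine PresentedGroup.ext fun i => ?_
  fin_cases i
  · exact hα
  · exact hβ
  · exact hγ

/-- The coordinates fix the translates `B' = αB`, `C' = βC` and `A' = γA`. Now `γ` carries the
generic triple `(A, B', C)` to `(A', B, C)`, and `α` carries `(A, C', B)` to `(A, C, B')`, so both
are determined; `β` follows from the relation. -/
theorem FramedRep.eq_of_coord_eq {R S : FramedRep} (hR : ∀ i, 0 < R.coord i)
    (h : R.coord = S.coord) (hA : R.flagα = S.flagα) (hB : R.flagβ = S.flagβ)
    (hC : R.flagγ = S.flagγ) : R = S := by
  have hS : ∀ i, 0 < S.coord i := h ▸ hR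
  have hgen := R.generic_of_coord_pos hR
  have hgen' := R.generic_of_coord_pos' hR
  have hB' : R.rho curveα • R.flagβ = S.rho curveα • R.flagβ := by
    have e₁ := congrFun h 1
    have e₂ := congrFun h 0
    have e₃ := congrFun h 7
    change cr₁ _ _ _ _ = cr₁ _ _ _ _ at e₁
    change cr₂ _ _ _ _ = cr₂ _ _ _ _ at e₂
    change tripleRatio _ _ _ = tripleRatio _ _ _ at e₃
    rw [← hA, ← hB, ← hC] at e₁ e₂ e₃
    exact Flag.eq_of_invariants_eq hgen.h₁₂ hgen.h₂₁ e₁ (hR 1).ne' e₂ (hR 0).ne' e₃ (hR 7).ne'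
  have hC' : R.rho curveβ • R.flagγ = S.rho curveβ • R.flagγ := by
    -- Inverting exchanges the second and fourth flags, which brings the unknown flag `C'` into the
    -- position needed for reconstruction.
    have e₁ := congrArg Inv.inv (congrFun h 2)
    have e₂ := congrArg Inv.inv (congrFun h 3)
    have e₃ := congrArg Inv.inv (congrFun h 7)
    change (cr₁ _ _ _ _)⁻¹ = (cr₁ _ _ _ _)⁻¹ at e₁
    change (cr₂ _ _ _ _)⁻¹ = (cr₂ _ _ _ _)⁻¹ at e₂
    change (tripleRatio _ _ _)⁻¹ = (tripleRatio _ _ _)⁻¹ at e₃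
    rw [← R.tripleRatio_flagγ', ← S.tripleRatio_flagγ'] at e₃
    rw [← cr₁_swap, ← cr₁_swap] at e₁
    rw [← cr₂_swap, ← cr₂_swap] at e₂
    rw [← hA, ← hB, ← hC] at e₁ e₂ e₃
    refine Flag.eq_of_invariants_eq hgen.h₁₃ hgen.h₃₁ e₁ ?_ e₂ ?_ e₃ ?_
    · rw [cr₁_swap]; exact inv_ne_zero (hR 2).ne'
    · rw [cr₂_swap]; exact inv_ne_zero (hR 3).ne'
    · rw [R.tripleRatio_flagγ']; exact inv_ne_zero (hR 7).ne'
  have hA' : R.rho curveγ • R.flagα = S.rho curveγ • R.flagα := by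
    have e₁ := congrFun h 5
    have e₂ := congrFun h 4
    have e₃ := congrFun h 7
    change cr₁ _ _ _ _ = cr₁ _ _ _ _ at e₁
    change cr₂ _ _ _ _ = cr₂ _ _ _ _ at e₂
    change tripleRatio _ _ _ = tripleRatio _ _ _ at e₃
    rw [← R.tripleRatio_flagα', ← S.tripleRatio_flagα'] at e₃
    rw [← hA, ← hB, ← hC] at e₁ e₂ e₃
    refine Flag.eq_of_invariants_eq hgen.h₂₃ hgen.h₃₂ e₁ (hR 5).ne' e₂ (hR 4).ne' e₃ ?_
    rw [R.tripleRatio_flagα']; exact (hR 7).ne'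
  have hγ : R.rho curveγ = S.rho curveγ := by
    rw [← inv_mul_eq_one]
    refine eq_one_of_smul_eq hgen' ?_ ?_ ?_ <;> rw [mul_smul, inv_smul_eq_iff]
    · exact hA'.symm
    · have := S.smul_flagβ'
      rw [← hB, ← hB'] at this
      rw [this, R.smul_flagβ']
    · have := S.fixγ
      rw [← hC] at this
      rw [this, R.fixγ]
  have hα : R.rho curveα = S.rho curveα := by
    rw [← inv_mul_eq_one]
    have hgen'' : Generic R.flagα (R.rho curveβ • R.flagγ) R.flagβ := by
      refine generic_of_tripleRatio_ne_zero ?_ fun h0 => (hR 2).ne' ?_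
      · rw [R.tripleRatio_flagγ']; exact inv_ne_zero (hR 7).ne'
      · change cr₁ _ _ _ _ = 0
        rw [← evLine_rotate, ← neg_eq_zero, ← evLine_swap, evLine_rotate] at h0
        rw [← evLine_rotate] at h0
        rw [cr₁, ← evLine_rotate R.flagα.point R.flagβ.point, h0]
        simp
    refine eq_one_of_smul_eq hgen'' ?_ ?_ ?_ <;> rw [mul_smul, inv_smul_eq_iff]
    · have := S.fixα
      rw [← hA] at this
      rw [this, R.fixα]
    · have := S.smul_flagγ'
      rw [← hC, ← hC'] at this
      rw [this, R.smul_flagγ']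
    · exact hB'.symm
  exact FramedRep.ext (FramedRep.rho_eq hα hγ) hA hB hC

theorem coord_injective : Function.Injective coord := by
  rintro ⟨x, hx⟩ ⟨y, hy⟩ h
  induction x using Quotient.inductionOn with | h R =>
  induction y using Quotient.inductionOn with | h S =>
  change R.coord = S.coord at h
  have hR : ∀ i, 0 < R.coord i := hx
  have hS : ∀ i, 0 < S.coord i := hy
  -- Coordinate 6 is the triple ratio of the base triangle, so a conjugation makes the three flags
  -- coincide.
  obtain ⟨g, hA, hC, hB⟩ := exists_smul_eq_of_tripleRatio_eq (S.generic_of_coord_pos hS)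
    (R.generic_of_coord_pos hR) (congrFun h 6).symm
  refine Subtype.ext (Quotient.sound ⟨g, ?_⟩)
  exact (FramedRep.eq_of_coord_eq hR (h.trans (S.coord_smul g).symm) hA.symm hB.symm hC.symm).symm

/-! ### The framed representation with given coordinates -/

/-- The monodromy of `α` up to a scalar, in the basis given by the points of the flags. -/
def matα (x : Fin 8 → ℝ) : Matrix (Fin 3) (Fin 3) ℝ :=
  !![x 6 * x 7 / (x 0 * x 2 * x 3), x 6 * (1 + 1 / x 0),
      x 6 * x 7 / (x 0 * x 2 * x 3) + x 6 * x 7 / (x 0 * x 2) +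
        x 6 * (1 + 1 / x 0) * (1 + 1 / x 2);
    0, -1, -(1 + 1 / x 2);
    0, 1 + x 1, x 1 + 1 + 1 / x 2]

/-- The monodromy of `γ⁻¹` up to a scalar, in the basis given by the points of the flags. -/
def matγ (x : Fin 8 → ℝ) : Matrix (Fin 3) (Fin 3) ℝ :=
  !![1 / x 0 + 1 + x 5, x 6 * (1 + 1 / x 0), 0;
    -(1 + x 5) / x 6, -1, 0;
    x 1 * x 5 * (1 + x 4) / (x 6 * x 7) + (1 + x 1) * (1 + x 5) / x 6, 1 + x 1,
      x 1 * x 4 * x 5 / (x 6 * x 7)]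

/-- The determinant of `matα`. -/
def detα (x : Fin 8 → ℝ) : ℝ := x 1 * x 6 * x 7 / (x 0 * x 2 ^ 2 * x 3)

/-- The determinant of `matγ`. -/
def detγ (x : Fin 8 → ℝ) : ℝ := x 1 * x 4 * x 5 ^ 2 / (x 0 * x 6 * x 7)

variable {x : Fin 8 → ℝ}

theorem det_matα (hx : x ∈ orthant) : (matα x).det = detα x := by
  have h := fun i => (hx i).ne'
  have h0 := h 0; have h2 := h 2; have h3 := h 3
  simp only [matα, detα, Matrix.det_fin_three, Matrix.of_apply, Matrix.cons_val', Matrix.cons_val]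
  field_simp
  ring

theorem det_matγ (hx : x ∈ orthant) : (matγ x).det = detγ x := by
  have h := fun i => (hx i).ne'
  have h0 := h 0; have h6 := h 6; have h7 := h 7
  simp only [matγ, detγ, Matrix.det_fin_three, Matrix.of_apply, Matrix.cons_val', Matrix.cons_val]
  field_simp
  ring

theorem detα_pos (hx : x ∈ orthant) : 0 < detα x := by
  have h0 := hx 0; have h1 := hx 1; have h2 := hx 2; have h3 := hx 3
  have h6 := hx 6; have h7 := hx 7
  unfold detα; positivity

theorem detγ_pos (hx : x ∈ orthant) : 0 < detγ x := by
  have h0 := hx 0; have h1 := hx 1; have h4 := hx 4; have h5 := hx 5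
  have h6 := hx 6; have h7 := hx 7
  unfold detγ; positivity

theorem rpow_neg_third_pow {d : ℝ} (hd : 0 < d) : (d ^ (-1 / 3 : ℝ)) ^ 3 = d⁻¹ := by
  rw [← Real.rpow_natCast, ← Real.rpow_mul hd.le, ← Real.rpow_neg_one]
  norm_num

/-- The monodromy of `α`. -/
def holα (hx : x ∈ orthant) : SL3 :=
  ⟨detα x ^ (-1 / 3 : ℝ) • matα x, by
    rw [Matrix.det_smul, Fintype.card_fin, det_matα hx, rpow_neg_third_pow (detα_pos hx),
      inv_mul_cancel₀ (detα_pos hx).ne']⟩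

/-- The monodromy of `γ⁻¹`. -/
def holγ (hx : x ∈ orthant) : SL3 :=
  ⟨detγ x ^ (-1 / 3 : ℝ) • matγ x, by
    rw [Matrix.det_smul, Fintype.card_fin, det_matγ hx, rpow_neg_third_pow (detγ_pos hx),
      inv_mul_cancel₀ (detγ_pos hx).ne']⟩

/-- The flag at the puncture of `α`. -/
def stdA : Flag := Flag.ofVec ![1, 0, 0] ![0, 1, 1] (by simp) (by simp) (by simp)

/-- The flag at the puncture of `β`. -/
def stdB : Flag := Flag.ofVec ![0, 1, 0] ![1, 0, 1] (by simp) (by simp) (by simp)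

/-- The flag at the puncture of `γ`. -/
def stdC (x : Fin 8 → ℝ) : Flag := Flag.ofVec ![0, 0, 1] ![1, x 6, 0] (by simp) (by simp) (by simp)

/-- The translate by `α` of the flag at the puncture of `β`. -/
def stdB' (x : Fin 8 → ℝ) : Flag :=
  Flag.ofVec ![x 6 * (1 + 1 / x 0), -1, 1 + x 1]
    ![1, x 6 * (1 + 1 / x 0) + x 6 * x 7 / (x 0 * x 1) * (1 + x 1), x 6 * x 7 / (x 0 * x 1)]
    (by simp) (by simp)
    (by simp only [dotProduct, Fin.sum_univ_three, Matrix.cons_val]; ring)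

theorem rep_stdA : stdA.Rep ![1, 0, 0] ![0, 1, 1] := Flag.rep_ofVec _ _ _

theorem rep_stdB : stdB.Rep ![0, 1, 0] ![1, 0, 1] := Flag.rep_ofVec _ _ _

theorem rep_stdC (x : Fin 8 → ℝ) : (stdC x).Rep ![0, 0, 1] ![1, x 6, 0] := Flag.rep_ofVec _ _ _

theorem rep_stdB' (x : Fin 8 → ℝ) : (stdB' x).Rep ![x 6 * (1 + 1 / x 0), -1, 1 + x 1]
    ![1, x 6 * (1 + 1 / x 0) + x 6 * x 7 / (x 0 * x 1) * (1 + x 1), x 6 * x 7 / (x 0 * x 1)] :=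
  Flag.rep_ofVec _ _ _

/-- The action of a rescaled matrix on flags. -/
theorem smul_flag_eq {g : SL3} {k : ℝ} {M : Matrix (Fin 3) (Fin 3) ℝ} (hk : k ≠ 0)
    (hg : (g : Matrix (Fin 3) (Fin 3) ℝ) = k • M) {F F' : Flag} {p l p' l' : Fin 3 → ℝ}
    (h : F.Rep p l) (h' : F'.Rep p' l') {a b : ℝ} (ha : a ≠ 0) (hb : b ≠ 0)
    (hp : M *ᵥ p = a • p') (hl : l' ᵥ* M = b • l) : g • F = F' := by
  rw [Flag.smul_eq_iff g h h']
  refine ⟨k * a, k * b, mul_ne_zero hk ha, mul_ne_zero hk hb, ?_, ?_⟩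
  · rw [hg, Matrix.smul_mulVec, hp, smul_smul]
  · rw [hg, Matrix.vecMul_smul, hl, smul_smul]

theorem holα_scale_ne_zero (hx : x ∈ orthant) : detα x ^ (-1 / 3 : ℝ) ≠ 0 :=
  (Real.rpow_pos_of_pos (detα_pos hx) _).ne'

theorem holγ_scale_ne_zero (hx : x ∈ orthant) : detγ x ^ (-1 / 3 : ℝ) ≠ 0 :=
  (Real.rpow_pos_of_pos (detγ_pos hx) _).ne'

theorem holα_smul_stdA (hx : x ∈ orthant) : holα hx • stdA = stdA := by
  have h0 := hx 0; have h1 := hx 1; have h2 := hx 2; have h3 := hx 3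
  have h6 := hx 6; have h7 := hx 7
  refine smul_flag_eq (holα_scale_ne_zero hx) rfl rep_stdA rep_stdA
    (a := x 6 * x 7 / (x 0 * x 2 * x 3)) (b := x 1) (by positivity) (by positivity) ?_ ?_ <;>
  · ext i
    fin_cases i <;> simp [matα, Matrix.mulVec, Matrix.vecMul, dotProduct, Fin.sum_univ_three] <;>
      ring

theorem holα_smul_stdB (hx : x ∈ orthant) : holα hx • stdB = stdB' x := by
  have h0 := hx 0; have h1 := hx 1; have h2 := hx 2; have h3 := hx 3
  have h6 := hx 6; have h7 := hx 7
  refine smul_flag_eq (holα_scale_ne_zero hx) rfl rep_stdB (rep_stdB' x)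
    (a := 1) (b := x 6 * x 7 / (x 0 * x 2 * x 3)) (by positivity) (by positivity) ?_ ?_
  · ext i
    fin_cases i <;> simp [matα, Matrix.mulVec, dotProduct, Fin.sum_univ_three]
  · ext i
    fin_cases i <;> simp [matα, Matrix.vecMul, dotProduct, Fin.sum_univ_three]
    field_simp; ring

/-- The monodromies of `α` and `γ⁻¹` send `B` to the same flag; this is why `β = α⁻¹γ⁻¹` fixes `B`.
-/
theorem holγ_smul_stdB (hx : x ∈ orthant) : holγ hx • stdB = stdB' x := by
  have h0 := hx 0; have h1 := hx 1; have h4 := hx 4; have h5 := hx 5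
  have h6 := hx 6; have h7 := hx 7
  refine smul_flag_eq (holγ_scale_ne_zero hx) rfl rep_stdB (rep_stdB' x)
    (a := 1) (b := x 4 * x 5 / x 0) (by positivity) (by positivity) ?_ ?_
  · ext i
    fin_cases i <;> simp [matγ, Matrix.mulVec, dotProduct, Fin.sum_univ_three]
  · ext i
    fin_cases i <;> simp [matγ, Matrix.vecMul, dotProduct, Fin.sum_univ_three] <;>
    · field_simp; try ring

theorem holγ_smul_stdC (hx : x ∈ orthant) : holγ hx • stdC x = stdC x := by
  have h0 := hx 0; have h1 := hx 1; have h4 := hx 4; have h5 := hx 5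
  have h6 := hx 6; have h7 := hx 7
  refine smul_flag_eq (holγ_scale_ne_zero hx) rfl (rep_stdC x) (rep_stdC x)
    (a := x 1 * x 4 * x 5 / (x 6 * x 7)) (b := 1 / x 0) (by positivity) (by positivity) ?_ ?_
  · ext i
    fin_cases i <;> simp [matγ, Matrix.mulVec, dotProduct, Fin.sum_univ_three]
  · ext i
    fin_cases i <;> simp [matγ, Matrix.vecMul, dotProduct, Fin.sum_univ_three] <;>
    · field_simp; try ring

/-- The framed representation with given coordinates. -/
def stdRep (hx : x ∈ orthant) : FramedRep where
  rho := PresentedGroup.toGroup (f := ![holα hx, (holα hx)⁻¹ * holγ hx, (holγ hx)⁻¹]) (by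
    intro r hr
    rw [Set.mem_singleton_iff] at hr
    subst hr
    simp)
  flagα := stdA
  flagβ := stdB
  flagγ := stdC x
  fixα := by
    rw [curveα, PresentedGroup.toGroup.of]
    exact holα_smul_stdA hx
  fixβ := by
    rw [curveβ, PresentedGroup.toGroup.of]
    change ((holα hx)⁻¹ * holγ hx) • stdB = stdB
    rw [mul_smul, inv_smul_eq_iff, holα_smul_stdB, holγ_smul_stdB]
  fixγ := by
    rw [curveγ, PresentedGroup.toGroup.of]
    change (holγ hx)⁻¹ • stdC x = stdC x
    rw [inv_smul_eq_iff, holγ_smul_stdC]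

theorem stdRep_rho_α (hx : x ∈ orthant) : (stdRep hx).rho curveα = holα hx := by
  rw [stdRep, curveα, PresentedGroup.toGroup.of]; rfl

theorem stdRep_rho_γ (hx : x ∈ orthant) : (stdRep hx).rho curveγ = (holγ hx)⁻¹ := by
  rw [stdRep, curveγ, PresentedGroup.toGroup.of]; rfl

theorem isRep_holα_smul_stdC (hx : x ∈ orthant) :
    IsRep (holα hx • stdC x).point (matα x *ᵥ ![0, 0, 1]) := by
  refine ((rep_stdC x).point.act (holα hx)).of_eq_smul (holα_scale_ne_zero hx) ?_
  exact Matrix.smul_mulVec _ _ _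

theorem isRep_holγ_smul_stdA (hx : x ∈ orthant) :
    IsRep (holγ hx • stdA).point (matγ x *ᵥ ![1, 0, 0]) := by
  refine (rep_stdA.point.act (holγ hx)).of_eq_smul (holγ_scale_ne_zero hx) ?_
  exact Matrix.smul_mulVec _ _ _

/-- The points of the three flags are the standard basis, and the lines are scaled so that the only
remaining parameter is the triple ratio `x 6`. Each coordinate is then a rational identity. -/
theorem coord_stdRep (hx : x ∈ orthant) : (stdRep hx).coord = x := by
  have hA : (stdRep hx).flagα = stdA := rfl
  have hB : (stdRep hx).flagβ = stdB := rfl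
  have hC : (stdRep hx).flagγ = stdC x := rfl
  have hB' : (stdRep hx).rho curveα • stdB = stdB' x := by
    rw [stdRep_rho_α, holα_smul_stdB]
  -- The quadrilateral `(A, C, B, C')` is moved by `α` to `(A, αC, B', C)`, and below `(C, A', B,
  -- A)` is moved by `γ⁻¹` to `(C, A, B', γ⁻¹A)`, so that no inverse matrix has to be written out.
  have c₁ := cr₁_smul (holα hx) stdA (stdC x) stdB ((stdRep hx).rho curveβ • stdC x)
  have c₂ := cr₂_smul (holα hx) stdA (stdC x) stdB ((stdRep hx).rho curveβ • stdC x)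
  have hC' := (stdRep hx).smul_flagγ'
  rw [stdRep_rho_α, hC] at hC'
  rw [holα_smul_stdA, holα_smul_stdB, hC'] at c₁ c₂
  have d₁ := cr₁_smul (holγ hx) (stdC x) ((holγ hx)⁻¹ • stdA) stdB stdA
  have d₂ := cr₂_smul (holγ hx) (stdC x) ((holγ hx)⁻¹ • stdA) stdB stdA
  rw [holγ_smul_stdC, smul_inv_smul, holγ_smul_stdB] at d₁ d₂
  rw [cr₂_eq_cr₁] at c₂ d₂
  simp only [FramedRep.coord, hA, hB, hC, hB', stdRep_rho_γ, ← c₁, ← c₂, ← d₁, ← d₂]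
  rw [cr₂_eq_cr₁, cr₁_eq (rep_stdC x) rep_stdB.point rep_stdA.point (rep_stdB' x).point,
    cr₁_eq rep_stdA (rep_stdB' x).point (rep_stdC x).point rep_stdB.point,
    cr₁_eq rep_stdA (isRep_holα_smul_stdC hx) (rep_stdB' x).point (rep_stdC x).point,
    cr₁_eq (rep_stdB' x) (rep_stdC x).point rep_stdA.point (isRep_holα_smul_stdC hx),
    cr₁_eq (rep_stdB' x) (isRep_holγ_smul_stdA hx) (rep_stdC x).point rep_stdA.point,
    cr₁_eq (rep_stdC x) rep_stdA.point (rep_stdB' x).point (isRep_holγ_smul_stdA hx),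
    tripleRatio_eq rep_stdA (rep_stdC x) rep_stdB,
    tripleRatio_eq rep_stdA (rep_stdB' x) (rep_stdC x)]
  have h0 := hx 0; have h1 := hx 1; have h2 := hx 2; have h3 := hx 3
  have h4 := hx 4; have h5 := hx 5; have h6 := hx 6; have h7 := hx 7
  simp only [matα, matγ, cross_apply, dotProduct, Fin.sum_univ_three, Matrix.mulVec,
    Matrix.cons_val, Matrix.of_apply, Matrix.cons_val', mul_zero, mul_one, zero_mul, add_zero,
    zero_add, one_mul, sub_zero, zero_sub, mul_neg, neg_mul, neg_neg]
  ext i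
  fin_cases i <;> simp only [Fin.zero_eta, Fin.mk_one, Fin.reduceFinMk, Matrix.cons_val]
  · field_simp; ring_nf
  · field_simp; ring_nf
  · field_simp; ring_nf; field_simp
  · field_simp; ring_nf; field_simp
  · field_simp; ring_nf; field_simp
  · field_simp; ring_nf
  · field_simp
  · field_simp; ring_nf

theorem coord_mem (q : FramedConvex) : coord q ∈ orthant := q.2

theorem exists_coord_eq (hx : x ∈ orthant) :
    ∃ h, coord ⟨Quotient.mk _ (stdRep hx), h⟩ = x :=
  ⟨fun i => show 0 < (stdRep hx).coord i by rw [coord_stdRep]; exact hx i, coord_stdRep hx⟩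

/-- The point with given coordinates. -/
def ofCoord (hx : x ∈ orthant) : FramedConvex := ⟨Quotient.mk _ (stdRep hx), (exists_coord_eq hx).1⟩

theorem coord_ofCoord (hx : x ∈ orthant) : coord (ofCoord hx) = x := (exists_coord_eq hx).2

theorem ofCoord_coord (q : FramedConvex) : ofCoord (coord_mem q) = q :=
  coord_injective (coord_ofCoord _)

/-! ### The trace function of the `Θ`-web in coordinates -/

/-- The trace of `α` in coordinates. -/
def trαFn (x : Fin 8 → ℝ) : ℝ :=
  detα x ^ (-1 / 3 : ℝ) * (x 6 * x 7 / (x 0 * x 2 * x 3) + x 1 + 1 / x 2)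

/-- The trace of `γ` in coordinates. -/
def trγFn (x : Fin 8 → ℝ) : ℝ :=
  (detγ x ^ (-1 / 3 : ℝ)) ^ 2 *
    (x 1 * x 4 * x 5 / (x 6 * x 7) * (1 / x 0 + x 5) + x 5 / x 0)

/-- The trace of `matα * matγ`. -/
def eightFn (x : Fin 8 → ℝ) : ℝ :=
  x 6 * x 7 / (x 0 * x 2 * x 3) * (1 / x 0 + 1 + x 5) +
  x 1 * x 4 * x 5 / (x 6 * x 7) * (x 1 + 1 + 1 / x 2) +
  (1 / x 0 + x 5 + x 5 / x 0) * (1 / x 2 + x 1 + x 1 / x 2) +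
  1 / (x 0 * x 2) * (1 + 1 / x 3) * x 1 * x 5 * (1 + x 4) +
  x 7 / (x 0 * x 2) * (1 + 1 / x 3) * (1 + x 1) * (1 + x 5) +
  (1 + 1 / x 0) * (1 + 1 / x 2) * x 1 * x 5 * (1 + x 4) / x 7

/-- The trace of the figure eight curve in coordinates. -/
def trδFn (x : Fin 8 → ℝ) : ℝ := detα x ^ (-1 / 3 : ℝ) * detγ x ^ (-1 / 3 : ℝ) * eightFn x

/-- The trace function of the `Θ`-web in coordinates. -/
def thetaFn (x : Fin 8 → ℝ) : ℝ := trαFn x * trγFn x - trδFn x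

theorem tr_ofCoord (c : PantsGroup) (hx : x ∈ orthant) :
    tr c (ofCoord hx) = ((stdRep hx).rho c : Matrix (Fin 3) (Fin 3) ℝ).trace := rfl

theorem tr_α_ofCoord (hx : x ∈ orthant) : tr curveα (ofCoord hx) = trαFn x := by
  rw [tr_ofCoord, stdRep_rho_α]
  change (detα x ^ (-1 / 3 : ℝ) • matα x).trace = _
  rw [Matrix.trace_smul, smul_eq_mul, trαFn, Matrix.trace_fin_three]
  simp only [matα, Matrix.of_apply, Matrix.cons_val', Matrix.cons_val]
  ring

theorem tr_γ_ofCoord (hx : x ∈ orthant) : tr curveγ (ofCoord hx) = trγFn x := by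
  have h0 := hx 0; have h6 := hx 6; have h7 := hx 7
  rw [tr_ofCoord, stdRep_rho_γ, Matrix.SpecialLinearGroup.coe_inv]
  change (detγ x ^ (-1 / 3 : ℝ) • matγ x).adjugate.trace = _
  -- The inverse in `SL(3, ℝ)` is the adjugate, which is quadratic in the entries; hence the squared
  -- scale factor in `trγFn`.
  rw [Matrix.adjugate_smul, Matrix.trace_smul, smul_eq_mul, trγFn, Matrix.adjugate_fin_three,
    Matrix.trace_fin_three]
  simp only [matγ, Matrix.of_apply, Matrix.cons_val', Matrix.cons_val, Fintype.card_fin]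
  field_simp
  ring

theorem tr_δ_ofCoord (hx : x ∈ orthant) : tr curveδ (ofCoord hx) = trδFn x := by
  have h0 := hx 0; have h1 := hx 1; have h2 := hx 2; have h3 := hx 3
  have h6 := hx 6; have h7 := hx 7
  rw [tr_ofCoord, curveδ, map_mul, map_inv, stdRep_rho_α, stdRep_rho_γ, inv_inv,
    Matrix.SpecialLinearGroup.coe_mul]
  change ((detα x ^ (-1 / 3 : ℝ) • matα x) * (detγ x ^ (-1 / 3 : ℝ) • matγ x)).trace = _
  rw [Matrix.smul_mul, Matrix.mul_smul, Matrix.trace_smul, Matrix.trace_smul, smul_eq_mul,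
    smul_eq_mul, trδFn, mul_assoc]
  congr 2
  rw [Matrix.trace_fin_three]
  simp only [Matrix.mul_apply, Fin.sum_univ_three, matα, matγ, Matrix.of_apply, Matrix.cons_val',
    Matrix.cons_val, eightFn]
  field_simp
  ring

theorem trTheta_eq (q : FramedConvex) : trTheta q = thetaFn (coord q) := by
  conv_lhs => rw [← ofCoord_coord q]
  rw [trTheta, tr_α_ofCoord, tr_γ_ofCoord, tr_δ_ofCoord, thetaFn]

/-! ### Smoothness -/

theorem isOpen_orthant : IsOpen orthant := by
  have : orthant = ⋂ i, {x : Fin 8 → ℝ | 0 < x i} := by ext x; simp [orthant]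
  rw [this]
  exact isOpen_iInter_of_finite fun i => isOpen_lt continuous_const (continuous_apply i)

theorem inCoord_coord (f : FramedConvex → ℝ) (q : FramedConvex) : inCoord f (coord q) = f q :=
  coord_injective.extend_apply _ _ _

theorem inCoord_eqOn {f : FramedConvex → ℝ} {F : (Fin 8 → ℝ) → ℝ} (h : ∀ q, f q = F (coord q)) :
    Set.EqOn (inCoord f) F orthant := by
  intro x hx
  rw [← coord_ofCoord hx, inCoord_coord, h]

theorem contDiffOn_thetaFn : ContDiffOn ℝ ∞ thetaFn orthant := by
  intro x hx
  apply ContDiffAt.contDiffWithinAt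
  have h0 := (hx 0).ne'; have h1 := (hx 1).ne'; have h2 := (hx 2).ne'; have h3 := (hx 3).ne'
  have h4 := (hx 4).ne'; have h5 := (hx 5).ne'; have h6 := (hx 6).ne'; have h7 := (hx 7).ne'
  have hα : ContDiffAt ℝ ∞ (fun x => detα x ^ (-1 / 3 : ℝ)) x := by
    refine ContDiffAt.rpow_const_of_ne ?_ (detα_pos hx).ne'
    unfold detα
    fun_prop (disch := simp [*])
  have hγ : ContDiffAt ℝ ∞ (fun x => detγ x ^ (-1 / 3 : ℝ)) x := by
    refine ContDiffAt.rpow_const_of_ne ?_ (detγ_pos hx).ne'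
    unfold detγ
    fun_prop (disch := simp [*])
  unfold thetaFn trαFn trγFn trδFn eightFn
  fun_prop (disch := simp [*])

theorem isSmooth_trTheta : IsSmooth trTheta :=
  contDiffOn_thetaFn.congr (inCoord_eqOn trTheta_eq)

/-! ### Hamiltonian curves in coordinates -/

/-- The exponents of the edge direction of the symplectic leaves. -/
def edgeDir : Fin 8 → ℝ := ![1, -1, 1, -1, 1, -1, 0, 0]

/-- The exponents of the triangle direction of the symplectic leaves. -/
def triDir : Fin 8 → ℝ := ![0, 0, 0, 0, 0, 0, 1, -1]

/-- The exchange matrix is the wedge of two vectors, so its rank is two and the leaves are surfaces.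
-/
theorem quiver_eq (i j : Fin 8) :
    quiver i j = edgeDir i * triDir j - triDir i * edgeDir j := by
  fin_cases i <;> fin_cases j <;> simp [quiver, edgeDir, triDir]

/-- The logarithmic derivative of `F` in the direction with exponents `d`. -/
def logDeriv (d : Fin 8 → ℝ) (F : (Fin 8 → ℝ) → ℝ) (x : Fin 8 → ℝ) : ℝ :=
  fderiv ℝ F x (fun j => d j * x j)

/-- The Hamiltonian vector field of a function of the coordinates. -/
def hamField (F : (Fin 8 → ℝ) → ℝ) (x : Fin 8 → ℝ) : Fin 8 → ℝ := fun i =>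
  2 * x i * (edgeDir i * logDeriv triDir F x - triDir i * logDeriv edgeDir F x)

theorem map_eq_sum_single (L : (Fin 8 → ℝ) →L[ℝ] ℝ) (y : Fin 8 → ℝ) :
    L y = ∑ j, y j * L (Pi.single j 1) := by
  conv_lhs => rw [pi_eq_sum_univ' y, map_sum]
  refine Finset.sum_congr rfl fun j _ => ?_
  rw [map_smul, smul_eq_mul]

theorem hamField_eq (F : (Fin 8 → ℝ) → ℝ) (x : Fin 8 → ℝ) (i : Fin 8) :
    hamField F x i = ∑ j, 2 * quiver i j * x i * x j * fderiv ℝ F x (Pi.single j 1) := by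
  rw [hamField, logDeriv, logDeriv, map_eq_sum_single _ (fun j => triDir j * x j),
    map_eq_sum_single _ (fun j => edgeDir j * x j), Finset.mul_sum, Finset.mul_sum,
    ← Finset.sum_sub_distrib, Finset.mul_sum]
  refine Finset.sum_congr rfl fun j _ => ?_
  rw [quiver_eq]
  ring

theorem bracket_eq (g f : FramedConvex → ℝ) (q : FramedConvex) :
    bracket g f q = fderiv ℝ (inCoord g) (coord q) (hamField (inCoord f) (coord q)) := by
  rw [map_eq_sum_single, bracket]
  refine Finset.sum_congr rfl fun i _ => ?_
  rw [hamField_eq, Finset.sum_mul]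
  refine Finset.sum_congr rfl fun j _ => ?_
  simp only [partialDeriv]
  ring

theorem fderiv_inCoord {f : FramedConvex → ℝ} {F : (Fin 8 → ℝ) → ℝ} (h : ∀ q, f q = F (coord q))
    (hx : x ∈ orthant) : fderiv ℝ (inCoord f) x = fderiv ℝ F x :=
  ((inCoord_eqOn h).eventuallyEq_of_mem (isOpen_orthant.mem_nhds hx)).fderiv_eq

/-- Testing against the eight coordinate functions gives the differential equation; the chain rule
recovers every other smooth test function. -/
theorem isHamiltonianCurveOn_iff {f : FramedConvex → ℝ} {F : (Fin 8 → ℝ) → ℝ}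
    (h : ∀ q, f q = F (coord q)) {c : ℝ → FramedConvex} {s : Set ℝ} :
    IsHamiltonianCurveOn f c s ↔ ∀ t ∈ s,
      HasDerivWithinAt (fun u => coord (c u)) (hamField F (coord (c t))) s t := by
  have hF (q : FramedConvex) : hamField (inCoord f) (coord q) = hamField F (coord q) := by
    ext i
    rw [hamField, hamField, logDeriv, logDeriv, logDeriv, logDeriv,
      fderiv_inCoord h (coord_mem q)]
  simp only [IsHamiltonianCurveOn, bracket_eq, hF]
  constructor
  · intro H t ht
    rw [hasDerivWithinAt_pi]
    intro i
    have hg (q : FramedConvex) : (fun q => coord q i) q = (fun x : Fin 8 → ℝ => x i) (coord q) :=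
      rfl
    have hs : IsSmooth fun q => coord q i :=
      (contDiff_apply ℝ ℝ i).contDiffOn.congr (inCoord_eqOn hg)
    have := H _ hs t ht
    rw [fderiv_inCoord (f := fun q => coord q i) (F := fun x => x i) hg (coord_mem _)] at this
    rwa [(hasFDerivAt_apply i (coord (c t))).fderiv] at this
  · intro H g hg t ht
    have hd : HasFDerivAt (inCoord g) (fderiv ℝ (inCoord g) (coord (c t))) (coord (c t)) :=
      ((hg.contDiffAt (isOpen_orthant.mem_nhds (coord_mem _))).differentiableAt
        (by simp)).hasFDerivAt
    have := hd.comp_hasDerivWithinAt t (H t ht)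
    refine this.congr_of_eventuallyEq (Filter.Eventually.of_forall fun u => ?_) ?_ <;>
      exact (inCoord_coord g _).symm

/-! ### Symplectic leaves in coordinates -/

/-- The leaf through the point with coordinates `x`, parametrized by the plane. -/
def leafPt (x : Fin 8 → ℝ) (z : ℂ) : Fin 8 → ℝ := fun i =>
  x i * Real.exp (edgeDir i * z.re + triDir i * z.im)

theorem leafPt_mem (hx : x ∈ orthant) (z : ℂ) : leafPt x z ∈ orthant := fun i =>
  mul_pos (hx i) (Real.exp_pos _)

theorem leafPt_zero (x : Fin 8 → ℝ) : leafPt x 0 = x := by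
  ext i; simp [leafPt]

theorem leafPt_add (x : Fin 8 → ℝ) (z w : ℂ) : leafPt x (z + w) = leafPt (leafPt x z) w := by
  ext i
  simp only [leafPt, Complex.add_re, Complex.add_im, mul_assoc, ← Real.exp_add]
  ring_nf

theorem log_leafPt (hx : x ∈ orthant) (z : ℂ) (i : Fin 8) :
    Real.log (leafPt x z i) = Real.log (x i) + (edgeDir i * z.re + triDir i * z.im) := by
  rw [leafPt, Real.log_mul (hx i).ne' (Real.exp_pos _).ne', Real.log_exp]

/-- The plane coordinate of a point of the leaf through `x`. -/
def leafParam (x y : Fin 8 → ℝ) : ℂ :=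
  ⟨Real.log (y 0) - Real.log (x 0), Real.log (y 6) - Real.log (x 6)⟩

theorem leafParam_leafPt (hx : x ∈ orthant) (z : ℂ) : leafParam x (leafPt x z) = z := by
  apply Complex.ext <;> simp [leafParam, log_leafPt hx, edgeDir, triDir]

theorem hasFDerivAt_leafPt (x : Fin 8 → ℝ) (z : ℂ) :
    HasFDerivAt (leafPt x) (ContinuousLinearMap.pi fun i =>
      leafPt x z i • (edgeDir i • Complex.reCLM + triDir i • Complex.imCLM)) z := by
  rw [hasFDerivAt_pi]
  intro i
  have h₁ : HasFDerivAt (fun z : ℂ => edgeDir i * z.re + triDir i * z.im)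
      (edgeDir i • Complex.reCLM + triDir i • Complex.imCLM) z :=
    (Complex.reCLM.hasFDerivAt.const_mul (edgeDir i)).add
      (Complex.imCLM.hasFDerivAt.const_mul (triDir i))
  refine (h₁.exp.const_mul (x i)).congr_fderiv ?_
  rw [smul_smul]
  rfl

/-- The Hamiltonian vector field of `G` on the plane, for twice the standard bracket. -/
def planeField (G : ℂ → ℝ) (z : ℂ) : ℂ := ⟨2 * fderiv ℝ G z Complex.I, -(2 * fderiv ℝ G z 1)⟩

/-- Partial derivatives of the pullback to the plane are logarithmic derivatives along the two
exponent vectors, so `leafPt` carries the planar Hamiltonian field to the ambient one. -/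
theorem hamField_leafPt {F : (Fin 8 → ℝ) → ℝ} {z : ℂ} (hF : DifferentiableAt ℝ F (leafPt x z))
    (i : Fin 8) : hamField F (leafPt x z) i = leafPt x z i *
      (edgeDir i * (planeField (F ∘ leafPt x) z).re +
        triDir i * (planeField (F ∘ leafPt x) z).im) := by
  have h := (hF.hasFDerivAt.comp z (hasFDerivAt_leafPt x z)).fderiv
  have h₁ : fderiv ℝ (F ∘ leafPt x) z 1 = logDeriv edgeDir F (leafPt x z) := by
    rw [h, logDeriv, ContinuousLinearMap.comp_apply]
    congr 1
    ext j
    simp [mul_comm]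
  have h₂ : fderiv ℝ (F ∘ leafPt x) z Complex.I = logDeriv triDir F (leafPt x z) := by
    rw [h, logDeriv, ContinuousLinearMap.comp_apply]
    congr 1
    ext j
    simp [mul_comm]
  rw [planeField, h₁, h₂, hamField]
  ring

theorem hasDerivWithinAt_leafParam {c : ℝ → Fin 8 → ℝ} {s : Set ℝ} {t : ℝ} {z : ℂ}
    (y : Fin 8 → ℝ) (hct : c t ∈ orthant)
    (h : HasDerivWithinAt c (fun i => c t i * (edgeDir i * z.re + triDir i * z.im)) s t) :
    HasDerivWithinAt (fun u => leafParam y (c u)) z s t := by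
  rw [hasDerivWithinAt_pi] at h
  have h₀ := ((h 0).log (hct 0).ne').sub_const (Real.log (y 0))
  have h₆ := ((h 6).log (hct 6).ne').sub_const (Real.log (y 6))
  rw [mul_div_cancel_left₀ _ (hct 0).ne'] at h₀
  rw [mul_div_cancel_left₀ _ (hct 6).ne'] at h₆
  have := h₀.ofReal_comp.add (h₆.ofReal_comp.mul_const Complex.I)
  refine (this.congr_deriv ?_).congr_of_eventuallyEq (Filter.Eventually.of_forall fun u => ?_) ?_
  · apply Complex.ext <;> simp [edgeDir, triDir]
  all_goals
    apply Complex.ext <;> simp [leafParam, -Complex.ofReal_sub]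

theorem hasDerivWithinAt_leafPt {γ : ℝ → ℂ} {s : Set ℝ} {t : ℝ} {z : ℂ} (y : Fin 8 → ℝ)
    (h : HasDerivWithinAt γ z s t) :
    HasDerivWithinAt (fun u => leafPt y (γ u))
      (fun i => leafPt y (γ t) i * (edgeDir i * z.re + triDir i * z.im)) s t := by
  have := (hasFDerivAt_leafPt y (γ t)).comp_hasDerivWithinAt t h
  refine this.congr_deriv ?_
  ext i
  simp [mul_add]

theorem eq_of_hasDerivWithinAt_zero {s : Set ℝ} (hs : Convex ℝ s) {f : ℝ → ℝ}
    (h : ∀ t ∈ s, HasDerivWithinAt f 0 s t) {a b : ℝ} (ha : a ∈ s) (hb : b ∈ s) : f a = f b := by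
  have := hs.norm_image_sub_le_of_norm_hasDerivWithin_le (C := 0) h (fun _ _ => by simp) hb ha
  rw [zero_mul, norm_le_zero_iff, sub_eq_zero] at this
  exact this

/-- Integral curves of Hamiltonian vector fields stay on the leaf. -/
theorem coord_eq_leafPt_of_curve {F : (Fin 8 → ℝ) → ℝ} {c : ℝ → Fin 8 → ℝ} {s : Set ℝ}
    (hs : Convex ℝ s) (hc : ∀ t ∈ s, c t ∈ orthant)
    (h : ∀ t ∈ s, HasDerivWithinAt c (hamField F (c t)) s t) {a b : ℝ} (ha : a ∈ s) (hb : b ∈ s) :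
    c b = leafPt (c a) (leafParam (c a) (c b)) := by
  have hlog (i : Fin 8) {t : ℝ} (ht : t ∈ s) : HasDerivWithinAt (fun u => Real.log (c u i))
      (2 * (edgeDir i * logDeriv triDir F (c t) - triDir i * logDeriv edgeDir F (c t))) s t := by
    have := (hasDerivWithinAt_pi.mp (h t ht) i).log (hc t ht i).ne'
    refine this.congr_deriv ?_
    rw [hamField]
    field_simp [(hc t ht i).ne']
  ext i
  -- Coordinates 0 and 6 read off the two plane parameters; what remains of each logarithm is a
  -- Casimir, constant along every Hamiltonian curve.
  have key := eq_of_hasDerivWithinAt_zero hs (f := fun t => Real.log (c t i) -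
    edgeDir i * Real.log (c t 0) - triDir i * Real.log (c t 6)) (fun t ht => by
      refine (((hlog i ht).sub ((hlog 0 ht).const_mul _)).sub
        ((hlog 6 ht).const_mul _)).congr_deriv ?_
      simp [edgeDir, triDir]
      ring) hb ha
  rw [← Real.exp_log (hc b hb i), leafPt]
  conv_rhs => rw [← Real.exp_log (hc a ha i), ← Real.exp_add]
  congr 1
  simp only [leafParam]
  linear_combination key

/-- A Hamiltonian that is linear in the logarithms generates translations of the plane, so one step
already reaches the whole leaf. -/
theorem step_iff {p q : FramedConvex} :
    HamiltonianStep p q ↔ ∃ z, coord q = leafPt (coord p) z := by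
  constructor
  · rintro ⟨f, -, c, hc, rfl, rfl⟩
    have hf (q : FramedConvex) : f q = inCoord f (coord q) := (inCoord_coord f q).symm
    rw [isHamiltonianCurveOn_iff hf] at hc
    exact ⟨_, coord_eq_leafPt_of_curve (convex_Icc 0 1) (fun t _ => coord_mem (c t)) hc
      (Set.left_mem_Icc.mpr zero_le_one) (Set.right_mem_Icc.mpr zero_le_one)⟩
  · rintro ⟨z, hz⟩
    have hp := coord_mem p
    -- Its planar Hamiltonian field is the constant `z`; the halves cancel the factor 2 of the
    -- bracket.
    set F : (Fin 8 → ℝ) → ℝ := fun x =>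
      -(z.im / 2) * Real.log (x 0) + (z.re / 2) * Real.log (x 6) with hFdef
    have hFd {x : Fin 8 → ℝ} (hx : x ∈ orthant) : ContDiffAt ℝ ∞ F x := by
      have h0 := (hx 0).ne'
      have h6 := (hx 6).ne'
      fun_prop (disch := assumption)
    have hF (q : FramedConvex) : (fun q => F (coord q)) q = F (coord q) := rfl
    refine ⟨fun q => F (coord q), ?_, fun t => ofCoord (leafPt_mem hp (t * z)), ?_, ?_, ?_⟩
    · exact ContDiffOn.congr (fun x hx => (hFd hx).contDiffWithinAt) (inCoord_eqOn hF)
    · rw [isHamiltonianCurveOn_iff hF]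
      intro t _
      simp only [coord_ofCoord]
      have hz : HasDerivWithinAt (fun t : ℝ => (t : ℂ) * z) z (Set.Icc 0 1) t := by
        simpa using ((hasDerivAt_id t).ofReal_comp.mul_const z).hasDerivWithinAt
      refine (hasDerivWithinAt_leafPt (coord p) hz).congr_deriv ?_
      ext i
      rw [hamField_leafPt ((hFd (leafPt_mem hp _)).differentiableAt (by simp))]
      have hre : HasFDerivAt (fun w : ℂ => w.re) Complex.reCLM (t * z) := Complex.reCLM.hasFDerivAt
      have him : HasFDerivAt (fun w : ℂ => w.im) Complex.imCLM (t * z) := Complex.imCLM.hasFDerivAt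
      have hcomp : F ∘ leafPt (coord p) = fun w => -(z.im / 2) * (Real.log (coord p 0) + w.re) +
          (z.re / 2) * (Real.log (coord p 6) + w.im) := by
        funext w
        simp [hFdef, log_leafPt hp, edgeDir, triDir]
      have hd := ((hre.const_add (Real.log (coord p 0))).const_mul (-(z.im / 2))).add
        ((him.const_add (Real.log (coord p 6))).const_mul (z.re / 2))
      rw [hcomp, planeField]
      rw [show fderiv ℝ (fun w : ℂ => -(z.im / 2) * (Real.log (coord p 0) + w.re) +
          (z.re / 2) * (Real.log (coord p 6) + w.im)) (t * z) = _ from hd.fderiv]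
      simp
      left
      ring
    · apply coord_injective
      simp [coord_ofCoord, leafPt_zero]
    · apply coord_injective
      simp [coord_ofCoord, hz]

theorem exists_eq_of_isSymplecticLeaf {Q : Set FramedConvex} (hQ : IsSymplecticLeaf Q) :
    ∃ p, Q = {q | ∃ z, coord q = leafPt (coord p) z} := by
  obtain ⟨p, rfl⟩ := hQ
  refine ⟨p, Set.ext fun q => ⟨fun h => ?_, fun h => .single (step_iff.mpr h)⟩⟩
  induction h with
  | refl => exact ⟨0, (leafPt_zero _).symm⟩
  | tail _ hs ih =>
    obtain ⟨z, hz⟩ := ih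
    obtain ⟨w, hw⟩ := step_iff.mp hs
    exact ⟨z + w, by rw [hw, hz, leafPt_add]⟩

open Set Metric

/-! ### Global integral curves of bounded Lipschitz vector fields -/

/-- With global bounds, Picard–Lindelöf works on every interval `[-a, a]`, in a ball of radius `L *
a`; uniqueness glues the solutions. -/
theorem exists_integralCurve_of_lipschitz_of_bounded {E : Type*} [NormedAddCommGroup E]
    [NormedSpace ℝ E] [CompleteSpace E] {W : E → E} {K L : NNReal} (hK : LipschitzWith K W)
    (hL : ∀ x, ‖W x‖ ≤ L) (x₀ : E) :
    ∃ γ : ℝ → E, γ 0 = x₀ ∧ ∀ t, HasDerivAt γ (W (γ t)) t := by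
  have loc (a : ℝ) (ha : 0 < a) : ∃ γ : ℝ → E, γ 0 = x₀ ∧
      ∀ t ∈ Ioo (-a) a, HasDerivAt γ (W (γ t)) t := by
    have h0 : (0 : ℝ) ∈ Icc (-a) a := ⟨by linarith, ha.le⟩
    have hpl : IsPicardLindelof (fun _ => W) (⟨0, h0⟩ : Icc (-a) a) x₀ (L * ⟨a, ha.le⟩) 0 L K :=
      { lipschitzOnWith := fun _ _ => hK.lipschitzOnWith
        continuousOn := fun _ _ => continuousOn_const
        norm_le := fun _ _ x _ => hL x
        mul_max_le := by simp; rfl }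
    obtain ⟨γ, hγ, hγ'⟩ := hpl.exists_eq_forall_mem_Icc_hasDerivWithinAt₀
    exact ⟨γ, hγ, fun t ht => (hγ' t (Ioo_subset_Icc_self ht)).hasDerivAt (Icc_mem_nhds ht.1 ht.2)⟩
  choose! γ hγ0 hγ using loc
  have agree {a b : ℝ} (ha : 0 < a) (hb : 0 < b) {t : ℝ} (hta : t ∈ Ioo (-a) a)
      (htb : t ∈ Ioo (-b) b) : γ a t = γ b t := by
    have hm : 0 < min a b := lt_min ha hb
    have ht : t ∈ Ioo (-(min a b)) (min a b) := by
      rw [mem_Ioo, ← abs_lt] at *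
      exact lt_min hta htb
    refine ODE_solution_unique_of_mem_Ioo (v := fun _ => W) (s := fun _ => univ) (t₀ := 0)
      (fun _ _ => hK.lipschitzOnWith) ⟨by linarith, hm⟩ (fun u hu => ⟨hγ a ha u ?_, trivial⟩)
      (fun u hu => ⟨hγ b hb u ?_, trivial⟩) ((hγ0 a ha).trans (hγ0 b hb).symm) ht
    · exact Ioo_subset_Ioo (neg_le_neg (min_le_left _ _)) (min_le_left _ _) hu
    · exact Ioo_subset_Ioo (neg_le_neg (min_le_right _ _)) (min_le_right _ _) hu
  have hmem (t : ℝ) : t ∈ Ioo (-(|t| + 1)) (|t| + 1) := by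
    rw [mem_Ioo, ← abs_lt]; linarith
  have hpos (t : ℝ) : 0 < |t| + 1 := by positivity
  refine ⟨fun t => γ (|t| + 1) t, hγ0 _ (hpos 0), fun t => ?_⟩
  refine (hγ _ (hpos t) t (hmem t)).congr_of_eventuallyEq ?_
  filter_upwards [Ioo_mem_nhds (hmem t).1 (hmem t).2] with u hu
  exact agree (hpos u) (hpos t) (hmem u) hu

/-! ### Hamiltonian flows of proper functions on the plane -/

theorem fderiv_plane (G : ℂ → ℝ) (z w : ℂ) :
    fderiv ℝ G z w = w.re * fderiv ℝ G z 1 + w.im * fderiv ℝ G z Complex.I := by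
  conv_lhs => rw [← Complex.re_add_im w]
  rw [map_add, ← mul_one (w.re : ℂ), ← Complex.real_smul, ← Complex.real_smul, map_smul, map_smul,
    smul_eq_mul, smul_eq_mul]

theorem fderiv_planeField (G : ℂ → ℝ) (z : ℂ) : fderiv ℝ G z (planeField G z) = 0 := by
  rw [fderiv_plane]
  simp only [planeField]
  ring

theorem planeField_eq (G : ℂ → ℝ) : planeField G = fun z =>
    ((2 * fderiv ℝ G z Complex.I : ℝ) : ℂ) + ((-(2 * fderiv ℝ G z 1) : ℝ) : ℂ) * Complex.I := by
  funext z
  exact Complex.mk_eq_add_mul_I _ _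

theorem contDiff_planeField {G : ℂ → ℝ} (hG : ContDiff ℝ ∞ G) : ContDiff ℝ 1 (planeField G) := by
  have hd : ContDiff ℝ 1 (fderiv ℝ G) := hG.fderiv_right (by norm_cast)
  have h (w : ℂ) : ContDiff ℝ 1 fun z => fderiv ℝ G z w := hd.clm_apply contDiff_const
  rw [planeField_eq]
  exact (Complex.ofRealCLM.contDiff.comp (contDiff_const.mul (h _))).add
    ((Complex.ofRealCLM.contDiff.comp (contDiff_const.mul (h _)).neg).mul contDiff_const)

theorem eq_of_hasDerivAt_of_fderiv_eq_zero {G : ℂ → ℝ} (hG : ContDiff ℝ ∞ G) {γ γ' : ℝ → ℂ}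
    (h : ∀ t, HasDerivAt γ (γ' t) t) (h0 : ∀ t, fderiv ℝ G (γ t) (γ' t) = 0) (s t : ℝ) :
    G (γ s) = G (γ t) := by
  refine eq_of_hasDerivWithinAt_zero convex_univ (f := G ∘ γ) (fun u _ => ?_) (mem_univ s)
    (mem_univ t)
  rw [← h0 u]
  exact (((hG.differentiable (by simp)) _).hasFDerivAt.comp_hasDerivAt u (h u)).hasDerivWithinAt

/-- Cutting the field off outside a ball around the superlevel set of the initial point makes it
bounded and Lipschitz. The cut-off field is still tangent to the level sets of `G`, so its orbit
never leaves the region where the cut-off is 1. -/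
theorem exists_planeField_curve {G : ℂ → ℝ} (hG : ContDiff ℝ ∞ G)
    (hb : ∀ a, Bornology.IsBounded {z | a ≤ G z}) (z : ℂ) :
    ∃ γ : ℝ → ℂ, γ 0 = z ∧ ∀ t, HasDerivAt γ (planeField G (γ t)) t := by
  obtain ⟨R, hR⟩ := (hb (G z)).subset_closedBall 0
  have hR0 : 0 < |R| + 1 := by positivity
  let χ : ContDiffBump (0 : ℂ) := ⟨|R| + 1, |R| + 2, hR0, by linarith⟩
  set W : ℂ → ℂ := fun w => χ w • planeField G w with hW
  have hWc : ContDiff ℝ 1 W := χ.contDiff.smul (contDiff_planeField hG)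
  have hWs : HasCompactSupport W := χ.hasCompactSupport.smul_right
  obtain ⟨K, hK⟩ := hWc.lipschitzWith_of_hasCompactSupport hWs one_ne_zero
  obtain ⟨L, hL⟩ := hWs.exists_bound_of_continuous hWc.continuous
  have hL0 : 0 ≤ L := (norm_nonneg _).trans (hL 0)
  obtain ⟨γ, hγ0, hγ⟩ := exists_integralCurve_of_lipschitz_of_bounded (L := ⟨L, hL0⟩) hK hL z
  refine ⟨γ, hγ0, fun t => ?_⟩
  have hG' := eq_of_hasDerivAt_of_fderiv_eq_zero hG hγ (fun t => by
    rw [hW, map_smul, fderiv_planeField, smul_zero]) 0 t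
  have hmem : γ t ∈ closedBall (0 : ℂ) R := hR (by rw [mem_ofPred, ← hG', hγ0])
  have : χ (γ t) = 1 := χ.one_of_mem_closedBall
    (closedBall_subset_closedBall ((le_abs_self R).trans (by linarith [abs_nonneg R])) hmem)
  have hd := hγ t
  simp only [hW] at hd
  rwa [this, one_smul] at hd

/-- Conservation of `G` keeps both curves in one closed ball, on which the field is Lipschitz. -/
theorem planeField_curve_unique {G : ℂ → ℝ} (hG : ContDiff ℝ ∞ G)
    (hb : ∀ a, Bornology.IsBounded {z | a ≤ G z}) {γ δ : ℝ → ℂ} (h0 : γ 0 = δ 0)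
    (hγ : ∀ t, HasDerivAt γ (planeField G (γ t)) t)
    (hδ : ∀ t, HasDerivAt δ (planeField G (δ t)) t) : γ = δ := by
  obtain ⟨R, hR⟩ := (hb (G (γ 0))).subset_closedBall 0
  obtain ⟨K, hK⟩ := (contDiff_planeField hG).contDiffOn.exists_lipschitzOnWith one_ne_zero
    (convex_closedBall (0 : ℂ) R) (isCompact_closedBall 0 R)
  refine ODE_solution_unique_univ (v := fun _ => planeField G) (s := fun _ => closedBall 0 R)
    (fun _ => hK) (fun t => ⟨hγ t, hR ?_⟩) (fun t => ⟨hδ t, hR ?_⟩) h0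
  · exact (eq_of_hasDerivAt_of_fderiv_eq_zero hG hγ (fun t => fderiv_planeField G _) 0 t).le
  · rw [h0]
    exact (eq_of_hasDerivAt_of_fderiv_eq_zero hG hδ (fun t => fderiv_planeField G _) 0 t).le

variable {G : ℂ → ℝ} {z₀ : ℂ}

/-- A function that decreases radially decreases strictly along rays. -/
theorem strictAntiOn_ray (hG : ContDiff ℝ ∞ G) (hz₀ : ∀ z, z ≠ z₀ → fderiv ℝ G z (z - z₀) < 0)
    {w : ℂ} (hw : w ≠ 0) : StrictAntiOn (fun r : ℝ => G (z₀ + r * w)) (Ici 0) := by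
  have hline (r : ℝ) : HasDerivAt (fun r : ℝ => z₀ + r * w) w r := by
    simpa using ((hasDerivAt_id r).ofReal_comp.mul_const w).const_add z₀
  have hd (r : ℝ) : HasDerivAt (fun r : ℝ => G (z₀ + r * w)) (fderiv ℝ G (z₀ + r * w) w) r :=
    ((hG.differentiable (by simp)) _).hasFDerivAt.comp_hasDerivAt r (hline r)
  refine strictAntiOn_of_deriv_neg (convex_Ici 0)
    (fun r _ => (hd r).continuousAt.continuousWithinAt) fun r hr => ?_
  rw [interior_Ici, mem_Ioi] at hr
  rw [(hd r).deriv]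
  have hne : z₀ + r * w ≠ z₀ := by simp [hr.ne', hw]
  have := hz₀ _ hne
  rw [add_sub_cancel_left, ← Complex.real_smul, map_smul, smul_eq_mul] at this
  exact neg_of_mul_neg_right this hr.le

theorem lt_of_ne_center (hG : ContDiff ℝ ∞ G) (hz₀ : ∀ z, z ≠ z₀ → fderiv ℝ G z (z - z₀) < 0)
    {z : ℂ} (hz : z ≠ z₀) : G z < G z₀ := by
  have := strictAntiOn_ray hG hz₀ (sub_ne_zero.mpr hz) self_mem_Ici
    (mem_Ici.mpr zero_le_one) zero_lt_one
  simpa using this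

theorem planeField_center (hG : ContDiff ℝ ∞ G)
    (hz₀ : ∀ z, z ≠ z₀ → fderiv ℝ G z (z - z₀) < 0) : planeField G z₀ = 0 := by
  have hmax : IsLocalMax G z₀ := Filter.Eventually.of_forall fun z => by
    rcases eq_or_ne z z₀ with rfl | hz
    · exact le_rfl
    · exact (lt_of_ne_center hG hz₀ hz).le
  rw [planeField, hmax.fderiv_eq_zero]
  apply Complex.ext <;> simp

/-- This imaginary part is the angular velocity around `z₀`. It equals minus twice the radial
derivative divided by the squared distance. -/
theorem im_planeField_div_pos (hz₀ : ∀ z, z ≠ z₀ → fderiv ℝ G z (z - z₀) < 0) {z : ℂ}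
    (hz : z ≠ z₀) : 0 < (planeField G z / (z - z₀)).im := by
  have h := hz₀ z hz
  have hn : 0 < Complex.normSq (z - z₀) := Complex.normSq_pos.mpr (sub_ne_zero.mpr hz)
  rw [Complex.div_im, ← sub_div]
  refine div_pos ?_ hn
  rw [fderiv_plane] at h
  simp only [planeField]
  linarith

/-- Orbits of the Hamiltonian flow of a radially decreasing proper function are periodic. -/
theorem exists_period (hG : ContDiff ℝ ∞ G) (hb : ∀ a, Bornology.IsBounded {z | a ≤ G z})
    (hz₀ : ∀ z, z ≠ z₀ → fderiv ℝ G z (z - z₀) < 0) {γ : ℝ → ℂ}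
    (hγ : ∀ t, HasDerivAt γ (planeField G (γ t)) t) :
    ∃ T : ℝ, 0 < T ∧ ∀ t, γ (t + T) = γ t := by
  -- The field is autonomous, so by uniqueness a single return to the starting point gives
  -- periodicity.
  suffices h : ∃ T : ℝ, 0 < T ∧ γ T = γ 0 by
    obtain ⟨T, hT, hT'⟩ := h
    refine ⟨T, hT, fun t => ?_⟩
    have hγT (t : ℝ) : HasDerivAt (fun t => γ (t + T)) (planeField G (γ (t + T))) t :=
      (hγ (t + T)).comp_add_const t T
    exact congrFun (planeField_curve_unique hG hb (by simpa using hT') hγT hγ) t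
  by_cases h0 : γ 0 = z₀
  · have : γ = fun _ => z₀ := planeField_curve_unique hG hb h0 hγ fun t => by
      rw [planeField_center hG hz₀]; exact hasDerivAt_const t z₀
    exact ⟨1, one_pos, by rw [this]⟩
  have hcons (t : ℝ) : G (γ t) = G (γ 0) :=
    eq_of_hasDerivAt_of_fderiv_eq_zero hG hγ (fun t => fderiv_planeField G _) t 0
  have hne (t : ℝ) : γ t ≠ z₀ := fun h => by
    have := lt_of_ne_center hG hz₀ h0
    rw [← hcons t, h] at this
    exact this.false
  have hne' (t : ℝ) : γ t - z₀ ≠ 0 := sub_ne_zero.mpr (hne t)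
  have hVc := (contDiff_planeField hG).continuous
  have hγc : Continuous γ := continuous_iff_continuousAt.mpr fun t => (hγ t).continuousAt
  -- the angular velocity is bounded below
  obtain ⟨ε, hε, hεle⟩ : ∃ ε > 0, ∀ t, ε ≤ (planeField G (γ t) / (γ t - z₀)).im := by
    have hK : IsCompact {z | G z = G (γ 0)} := Metric.isCompact_of_isClosed_isBounded
      (isClosed_eq hG.continuous continuous_const) ((hb (G (γ 0))).subset fun z hz => hz.ge)
    have hKne (z : ℂ) (hz : G z = G (γ 0)) : z ≠ z₀ := by
      rintro rfl
      exact (lt_of_ne_center hG hz₀ h0).ne hz.symm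
    have hcont : ContinuousOn (fun z => (planeField G z / (z - z₀)).im) {z | G z = G (γ 0)} :=
      Complex.continuous_im.comp_continuousOn (hVc.continuousOn.div
        (continuous_id.sub continuous_const).continuousOn fun z hz => sub_ne_zero.mpr (hKne z hz))
    obtain ⟨w, hw, hmin⟩ := hK.exists_isMinOn ⟨γ 0, rfl⟩ hcont
    exact ⟨_, im_planeField_div_pos hz₀ (hKne w hw), fun t => hmin (hcons t)⟩
  -- the logarithm of the position
  set q : ℝ → ℂ := fun t => planeField G (γ t) / (γ t - z₀) with hq
  have hqc : Continuous q := (hVc.comp hγc).div (hγc.sub continuous_const) hne'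
  set Λ : ℝ → ℂ := fun t => ∫ s in (0 : ℝ)..t, q s
  have hΛd (t : ℝ) : HasDerivAt Λ (q t) t := hqc.integral_hasStrictDerivAt 0 t |>.hasDerivAt
  have hΛ0 : Λ 0 = 0 := intervalIntegral.integral_same
  have hpos (t : ℝ) : γ t - z₀ = Complex.exp (Λ t) * (γ 0 - z₀) := by
    have hd (t : ℝ) : HasDerivAt (fun t => Complex.exp (-Λ t) * (γ t - z₀)) 0 t := by
      refine (((hΛd t).neg.cexp).mul ((hγ t).sub_const z₀)).congr_deriv ?_
      rw [hq]
      field_simp [hne' t]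
      ring
    have := is_const_of_deriv_eq_zero (fun t => (hd t).differentiableAt) (fun t => (hd t).deriv) t 0
    simp only [hΛ0, neg_zero, Complex.exp_zero, one_mul] at this
    rw [← this, ← mul_assoc, ← Complex.exp_add, add_neg_cancel, Complex.exp_zero, one_mul]
  have him (t : ℝ) : HasDerivAt (fun t => (Λ t).im) (q t).im t :=
    Complex.imCLM.hasFDerivAt.comp_hasDerivAt t (hΛd t)
  have him' (t : ℝ) : HasDerivAt (fun t => (Λ t).im - ε * t) ((q t).im - ε * 1) t :=
    (him t).sub ((hasDerivAt_id t).const_mul ε)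
  have hmono : Monotone fun t => (Λ t).im - ε * t :=
    monotone_of_deriv_nonneg (fun t => (him' t).differentiableAt) fun t => by
      rw [(him' t).deriv, mul_one]
      exact sub_nonneg.mpr (hεle t)
  -- Angular velocity at least `ε` completes a full turn by time `2π / ε`.
  have hbig : 2 * Real.pi ≤ (Λ (2 * Real.pi / ε)).im := by
    have := hmono (show (0 : ℝ) ≤ 2 * Real.pi / ε by positivity)
    simp only [hΛ0, Complex.zero_im, mul_zero, sub_zero, mul_div_cancel₀ _ hε.ne'] at this
    linarith
  obtain ⟨T, hT, hT'⟩ := intermediate_value_Icc (show (0 : ℝ) ≤ 2 * Real.pi / ε by positivity)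
    (fun t _ => (him t).continuousAt.continuousWithinAt)
    (show 2 * Real.pi ∈ Icc ((Λ 0).im) ((Λ (2 * Real.pi / ε)).im) from
      ⟨by rw [hΛ0, Complex.zero_im]; positivity, hbig⟩)
  have hTpos : 0 < T := by
    refine lt_of_le_of_ne hT.1 ?_
    rintro rfl
    simp only [hΛ0, Complex.zero_im] at hT'
    linarith [Real.pi_pos]
  refine ⟨T, hTpos, ?_⟩
  have hexp : Complex.exp (Λ T) = (Real.exp (Λ T).re : ℝ) := by
    rw [← Complex.re_add_im (Λ T), show (Λ T).im = 2 * Real.pi from hT', Complex.exp_add]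
    push_cast
    rw [Complex.exp_two_pi_mul_I]
    simp
  have hray := hpos T
  rw [hexp, sub_eq_iff_eq_add'] at hray
  -- After the full turn the orbit is on its initial ray at the initial value of `G`, and `G` is
  -- injective on that ray.
  have hinj := (strictAntiOn_ray hG hz₀ (hne' 0)).injOn (mem_Ici.mpr (Real.exp_pos (Λ T).re).le)
    (mem_Ici.mpr zero_le_one) (by
      rw [← hray, hcons T]
      simp)
  rw [hray, hinj]
  simp

/-! ### Sums of exponentials on the plane -/

section ExpSum

variable {ι : Type*} [Fintype ι] {c : ι → ℝ} {L : ι → ℂ →L[ℝ] ℝ} {K : ℝ}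

theorem contDiff_expSum (c : ι → ℝ) (L : ι → ℂ →L[ℝ] ℝ) (K : ℝ) :
    ContDiff ℝ ∞ fun z => K - ∑ k, c k * Real.exp (L k z) :=
  contDiff_const.sub (ContDiff.sum fun k _ => contDiff_const.mul (L k).contDiff.exp)

theorem fderiv_expSum (c : ι → ℝ) (L : ι → ℂ →L[ℝ] ℝ) (K : ℝ) (z w : ℂ) :
    fderiv ℝ (fun z => K - ∑ k, c k * Real.exp (L k z)) z w =
      -∑ k, c k * Real.exp (L k z) * L k w := by
  have h : HasFDerivAt (fun z => K - ∑ k, c k * Real.exp (L k z))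
      (-∑ k, c k • Real.exp (L k z) • L k) z :=
    (HasFDerivAt.fun_sum fun k _ => (L k).hasFDerivAt.exp.const_mul (c k)).const_sub K
  rw [h.fderiv]
  simp [mul_assoc]

/-- In every direction some exponent grows at least like the norm, and its term alone dominates a
multiple of `‖z‖`. -/
theorem isBounded_expSum (hc : ∀ k, 0 < c k) (hL : ∀ z, ∃ k, ‖z‖ ≤ L k z) (a : ℝ) :
    Bornology.IsBounded {z | a ≤ K - ∑ k, c k * Real.exp (L k z)} := by
  have : Nonempty ι := ⟨(hL 0).choose⟩
  obtain ⟨k₀, hk₀⟩ := Finite.exists_min c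
  refine (isBounded_closedBall (x := (0 : ℂ)) (r := (K - a) / c k₀)).subset fun z hz => ?_
  rw [mem_closedBall_zero_iff, le_div_iff₀ (hc k₀)]
  obtain ⟨k, hk⟩ := hL z
  have h₁ : c k * Real.exp (L k z) ≤ ∑ k, c k * Real.exp (L k z) :=
    Finset.single_le_sum (f := fun k => c k * Real.exp (L k z))
      (fun k _ => (mul_pos (hc k) (Real.exp_pos _)).le) (Finset.mem_univ k)
  have h₂ : ‖z‖ ≤ Real.exp (L k z) := hk.trans ((by linarith : L k z ≤ L k z + 1).trans
    (Real.add_one_le_exp _))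
  have h₃ : ‖z‖ * c k₀ ≤ c k * Real.exp (L k z) := by
    rw [mul_comm]
    exact mul_le_mul (hk₀ k) h₂ (norm_nonneg z) (hc k).le
  rw [mem_ofPred] at hz
  linarith

/-- The centre is a maximum point, which exists by properness. Since the differential vanishes
there, the sign of the radial derivative elsewhere follows termwise from monotonicity of `exp`,
strictly for an exponent that grows in the direction `z - z₀`. -/
theorem exists_center_expSum (hc : ∀ k, 0 < c k) (hL : ∀ z, ∃ k, ‖z‖ ≤ L k z) :
    ∃ z₀, ∀ z, z ≠ z₀ → fderiv ℝ (fun z => K - ∑ k, c k * Real.exp (L k z)) z (z - z₀) < 0 := by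
  set G : ℂ → ℝ := fun z => K - ∑ k, c k * Real.exp (L k z) with hG
  have hGc : Continuous G := (contDiff_expSum c L K).continuous
  have hcpt : IsCompact {z | G 0 ≤ G z} := Metric.isCompact_of_isClosed_isBounded
    (isClosed_le continuous_const hGc) (isBounded_expSum hc hL _)
  obtain ⟨z₀, hz₀, hmax⟩ := hcpt.exists_isMaxOn ⟨0, le_refl (G 0)⟩ hGc.continuousOn
  have hmax' : IsLocalMax G z₀ := Filter.Eventually.of_forall fun z => by
    by_cases hz : G 0 ≤ G z
    · exact hmax hz
    · exact (not_le.mp hz).le.trans hz₀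
  refine ⟨z₀, fun z hz => ?_⟩
  have h0 : fderiv ℝ G z₀ (z - z₀) = 0 := by rw [hmax'.fderiv_eq_zero]; rfl
  rw [← h0, hG, fderiv_expSum, fderiv_expSum, neg_lt_neg_iff]
  have hterm (a b : ℝ) : Real.exp a * (b - a) ≤ Real.exp b * (b - a) ∧
      (a < b → Real.exp a * (b - a) < Real.exp b * (b - a)) := by
    constructor
    · rcases le_total a b with h | h
      · exact mul_le_mul_of_nonneg_right (Real.exp_le_exp.mpr h) (sub_nonneg.mpr h)
      · exact mul_le_mul_of_nonpos_right (Real.exp_le_exp.mpr h) (sub_nonpos.mpr h)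
    · intro h
      exact mul_lt_mul_of_pos_right (Real.exp_lt_exp.mpr h) (sub_pos.mpr h)
  obtain ⟨k, hk⟩ := hL (z - z₀)
  have hk' : L k z₀ < L k z := by
    rw [← sub_pos, ← map_sub]
    exact (norm_pos_iff.mpr (sub_ne_zero.mpr hz)).trans_le hk
  simp only [mul_assoc, map_sub]
  exact Finset.sum_lt_sum
    (fun k _ => mul_le_mul_of_nonneg_left (hterm _ _).1 (hc k).le)
    ⟨k, Finset.mem_univ k, mul_lt_mul_of_pos_left ((hterm _ _).2 hk') (hc k)⟩

end ExpSum

/-! ### The trace functions on a symplectic leaf -/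

theorem leafPt_eq (x : Fin 8 → ℝ) (z : ℂ) : leafPt x z =
    ![x 0 * Real.exp z.re, x 1 / Real.exp z.re, x 2 * Real.exp z.re, x 3 / Real.exp z.re,
      x 4 * Real.exp z.re, x 5 / Real.exp z.re, x 6 * Real.exp z.im, x 7 / Real.exp z.im] := by
  ext i
  fin_cases i <;> simp [leafPt, edgeDir, triDir, Real.exp_neg, div_eq_mul_inv]

theorem rpow_neg_third_mul_inv_cube {d e : ℝ} (hd : 0 < d) (he : 0 < e) :
    (d / e ^ 3) ^ (-1 / 3 : ℝ) = d ^ (-1 / 3 : ℝ) * e := by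
  rw [Real.div_rpow hd.le (by positivity), ← Real.rpow_natCast, ← Real.rpow_mul he.le,
    show ((3 : ℕ) : ℝ) * (-1 / 3) = -1 by norm_num, Real.rpow_neg_one, div_inv_eq_mul]

/-- The determinant is homogeneous of degree -3 in the edge direction and invariant in the triangle
direction. -/
theorem detα_leafPt (hx : x ∈ orthant) (z : ℂ) :
    detα (leafPt x z) ^ (-1 / 3 : ℝ) = detα x ^ (-1 / 3 : ℝ) * Real.exp z.re := by
  rw [← rpow_neg_third_mul_inv_cube (detα_pos hx) (Real.exp_pos _)]
  congr 1
  have hE := Real.exp_pos z.re; have hT := Real.exp_pos z.im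
  have h0 := hx 0; have h2 := hx 2; have h3 := hx 3
  simp only [detα, leafPt_eq, Matrix.cons_val]
  field_simp

theorem detγ_leafPt (hx : x ∈ orthant) (z : ℂ) :
    detγ (leafPt x z) ^ (-1 / 3 : ℝ) = detγ x ^ (-1 / 3 : ℝ) * Real.exp z.re := by
  rw [← rpow_neg_third_mul_inv_cube (detγ_pos hx) (Real.exp_pos _)]
  congr 1
  have hE := Real.exp_pos z.re; have hT := Real.exp_pos z.im
  have h0 := hx 0; have h6 := hx 6; have h7 := hx 7
  simp only [detγ, leafPt_eq, Matrix.cons_val]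
  field_simp

/-- Boundary traces are Casimirs: all three monomials scale by `exp (-z.re)`, which the normalizing
factor cancels. -/
theorem trαFn_leafPt (hx : x ∈ orthant) (z : ℂ) : trαFn (leafPt x z) = trαFn x := by
  rw [trαFn, trαFn, detα_leafPt hx, mul_assoc]
  congr 1
  have hE := Real.exp_pos z.re; have hT := Real.exp_pos z.im
  have h0 := hx 0; have h2 := hx 2; have h3 := hx 3
  simp only [leafPt_eq, Matrix.cons_val]
  field_simp

theorem trγFn_leafPt (hx : x ∈ orthant) (z : ℂ) : trγFn (leafPt x z) = trγFn x := by
  rw [trγFn, trγFn, detγ_leafPt hx, mul_pow, mul_assoc]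
  congr 1
  have hE := Real.exp_pos z.re; have hT := Real.exp_pos z.im
  have h0 := hx 0; have h6 := hx 6; have h7 := hx 7
  simp only [leafPt_eq, Matrix.cons_val]
  field_simp

/-- The exponents of the trace of the figure eight curve on a leaf. -/
def eightExp (k : Fin 4 × Fin 3) : ℂ →L[ℝ] ℝ :=
  ((k.1 : ℝ) - 2) • Complex.reCLM + ((k.2 : ℝ) - 1) • Complex.imCLM

/-- The coefficients of the trace of `matα * matγ` on the leaf through `x`. -/
def eightCoeff (x : Fin 8 → ℝ) : Matrix (Fin 4) (Fin 3) ℝ :=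
  !![x 7 / (x 0 * x 2) * (x 1 * x 5),
      x 5 / x 0 * (x 1 / x 2) + x 1 * x 5 / (x 0 * x 2),
      x 1 * x 5 / x 7 * (1 / (x 0 * x 2));
    x 7 / (x 0 * x 2) * (x 1 + x 5 + x 1 * x 5 / x 3),
      (1 / x 0 + x 5) * (x 1 / x 2) + x 5 / x 0 * (1 / x 2 + x 1) +
        x 1 * x 5 / (x 0 * x 2) * (1 / x 3 + x 4),
      x 1 * x 5 / x 7 * (1 / x 0 + 1 / x 2 + x 4 / (x 0 * x 2));
    x 7 / (x 0 * x 2) * (1 + (x 1 + x 5) / x 3),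
      x 6 * x 7 / (x 0 * x 2 * x 3) * (1 / x 0 + x 5) +
        x 1 * x 4 * x 5 / (x 6 * x 7) * (x 1 + 1 / x 2) +
        (1 / x 0 + x 5) * (1 / x 2 + x 1) + x 1 * x 4 * x 5 / (x 0 * x 2 * x 3),
      x 1 * x 5 / x 7 * (1 + x 4 * (1 / x 0 + 1 / x 2));
    x 7 / (x 0 * x 2) * (1 / x 3),
      x 6 * x 7 / (x 0 * x 2 * x 3) + x 1 * x 4 * x 5 / (x 6 * x 7),
      x 1 * x 5 / x 7 * x 4]

theorem eightCoeff_pos (hx : x ∈ orthant) (i : Fin 4) (j : Fin 3) : 0 < eightCoeff x i j := by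
  have h0 := hx 0; have h1 := hx 1; have h2 := hx 2; have h3 := hx 3
  have h4 := hx 4; have h5 := hx 5; have h6 := hx 6; have h7 := hx 7
  fin_cases i <;> fin_cases j <;>
    simp only [eightCoeff, Matrix.of_apply, Matrix.cons_val', Matrix.cons_val, Fin.zero_eta,
      Fin.mk_one, Fin.reduceFinMk] <;>
    positivity

theorem exp_eightExp (k : Fin 4 × Fin 3) (z : ℂ) : Real.exp (eightExp k z) =
    Real.exp z.re ^ (k.1 : ℕ) * Real.exp z.im ^ (k.2 : ℕ) /
      (Real.exp z.re ^ 2 * Real.exp z.im) := by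
  rw [← Real.exp_nat_mul, ← Real.exp_nat_mul, ← Real.exp_nat_mul, ← Real.exp_add, ← Real.exp_add,
    ← Real.exp_sub]
  congr 1
  simp [eightExp]
  ring

/-- The exponents fill the grid `{-2, …, 1} × {-1, 0, 1}`; the corner in the quadrant of `z`
dominates `|re| + |im|`. -/
theorem exists_norm_le_eightExp (z : ℂ) : ∃ k, ‖z‖ ≤ eightExp k z := by
  have h := Complex.norm_le_abs_re_add_abs_im z
  have hre : ∃ i : Fin 4, |z.re| ≤ ((i : ℝ) - 2) * z.re := by
    rcases le_total 0 z.re with h | h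
    · exact ⟨3, by rw [abs_of_nonneg h]; norm_num⟩
    · exact ⟨0, by rw [abs_of_nonpos h]; simp; linarith⟩
  have him : ∃ j : Fin 3, |z.im| ≤ ((j : ℝ) - 1) * z.im := by
    rcases le_total 0 z.im with h | h
    · exact ⟨2, by rw [abs_of_nonneg h]; norm_num⟩
    · exact ⟨0, by rw [abs_of_nonpos h]; simp⟩
  obtain ⟨i, hi⟩ := hre
  obtain ⟨j, hj⟩ := him
  refine ⟨(i, j), h.trans ?_⟩
  simpa [eightExp] using add_le_add hi hj

/-- The factor `exp z.re ^ 2` comes from the two determinant normalizations. In `E = exp z.re` and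
`T = exp z.im` the claim is an identity of rational functions. -/
theorem eightFn_leafPt (hx : x ∈ orthant) (z : ℂ) :
    Real.exp z.re ^ 2 * eightFn (leafPt x z) =
      ∑ k : Fin 4 × Fin 3, eightCoeff x k.1 k.2 * Real.exp (eightExp k z) := by
  have hE := Real.exp_pos z.re; have hT := Real.exp_pos z.im
  have h0 := hx 0; have h1 := hx 1; have h2 := hx 2; have h3 := hx 3
  have h4 := hx 4; have h5 := hx 5; have h6 := hx 6; have h7 := hx 7
  simp only [exp_eightExp, Fintype.sum_prod_type, Fin.sum_univ_four, Fin.sum_univ_three,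
    eightFn, leafPt_eq, eightCoeff, Matrix.of_apply, Matrix.cons_val', Matrix.cons_val]
  generalize Real.exp z.re = E at *
  generalize Real.exp z.im = T at *
  simp only [Fin.val_zero, Fin.val_one, Fin.val_two, show ((3 : Fin 4) : ℕ) = 3 from rfl,
    pow_zero, pow_one]
  field_simp
  ring

/-- The coefficients of the trace of the figure eight curve on the leaf through `x`. -/
def δCoeff (x : Fin 8 → ℝ) (k : Fin 4 × Fin 3) : ℝ :=
  detα x ^ (-1 / 3 : ℝ) * detγ x ^ (-1 / 3 : ℝ) * eightCoeff x k.1 k.2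

theorem δCoeff_pos (hx : x ∈ orthant) (k : Fin 4 × Fin 3) : 0 < δCoeff x k :=
  mul_pos (mul_pos (Real.rpow_pos_of_pos (detα_pos hx) _) (Real.rpow_pos_of_pos (detγ_pos hx) _))
    (eightCoeff_pos hx _ _)

/-- The trace function of the `Θ`-web on a leaf is a constant minus a positive sum of
exponentials. -/
theorem thetaFn_comp_leafPt (hx : x ∈ orthant) : thetaFn ∘ leafPt x =
    fun z => trαFn x * trγFn x - ∑ k, δCoeff x k * Real.exp (eightExp k z) := by
  funext z
  simp only [Function.comp_apply, thetaFn, trαFn_leafPt hx, trγFn_leafPt hx, trδFn,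
    detα_leafPt hx, detγ_leafPt hx, δCoeff, mul_assoc, ← Finset.mul_sum]
  rw [← eightFn_leafPt hx]
  ring

/-- Hamiltonian curves of the trace function of the `Θ`-web on a leaf are integral curves in the
plane. -/
theorem isHamiltonianCurveOn_trTheta_iff (hx : x ∈ orthant) {c : ℝ → FramedConvex} {γ : ℝ → ℂ}
    (hc : ∀ t, coord (c t) = leafPt x (γ t)) : IsHamiltonianCurveOn trTheta c Set.univ ↔
      ∀ t, HasDerivAt γ (planeField (thetaFn ∘ leafPt x) (γ t)) t := by
  have hd (t : ℝ) : DifferentiableAt ℝ thetaFn (leafPt x (γ t)) :=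
    (contDiffOn_thetaFn.contDiffAt (isOpen_orthant.mem_nhds (leafPt_mem hx _))).differentiableAt
      (by simp)
  have hfield (t : ℝ) := funext fun i => hamField_leafPt (hd t) i
  simp only [isHamiltonianCurveOn_iff trTheta_eq, hc, hfield, Set.mem_univ, true_imp_iff]
  refine forall_congr' fun t => ?_
  rw [← hasDerivWithinAt_univ]
  refine ⟨fun h => ?_, fun h => hasDerivWithinAt_leafPt x h⟩
  have := hasDerivWithinAt_leafParam x (leafPt_mem hx (γ t)) h
  simpa only [leafParam_leafPt hx] using this

end Pants

end

/-- On every symplectic leaf of the space of framed convex projective structures on the pair of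
pants, the trace function of the `Θ`-web, which is smooth, has a unique maximum; its Hamiltonian
flow exists for all times and is unique, all its orbits are periodic, and it has a unique fixed
point. -/
theorem corollaryB :
    Pants.IsSmooth Pants.trTheta ∧
    ∀ Q : Set Pants.FramedConvex, Pants.IsSymplecticLeaf Q →
      (∃! q : Q, ∀ q' : Q, Pants.trTheta q' ≤ Pants.trTheta q) ∧
      ∃ Φ : ℝ → Q → Q, Pants.IsHamiltonianFlow Pants.trTheta Q Φ ∧
        (∀ Ψ : ℝ → Q → Q, Pants.IsHamiltonianFlow Pants.trTheta Q Ψ → Ψ = Φ) ∧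
        (∀ q : Q, ∃ T : ℝ, 0 < T ∧ ∀ t : ℝ, Φ (t + T) q = Φ t q) ∧
        ∃! q : Q, ∀ t : ℝ, Φ t q = q := by
  refine ⟨Pants.isSmooth_trTheta, fun Q hQ => ?_⟩
  obtain ⟨p, hp⟩ := Pants.exists_eq_of_isSymplecticLeaf hQ
  have hx := Pants.coord_mem p
  generalize Pants.coord p = x at hp hx
  have hG : ContDiff ℝ ∞ (Pants.thetaFn ∘ Pants.leafPt x) := by
    rw [Pants.thetaFn_comp_leafPt hx]
    exact Pants.contDiff_expSum _ _ _
  have hb (a : ℝ) : Bornology.IsBounded {z | a ≤ (Pants.thetaFn ∘ Pants.leafPt x) z} := by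
    rw [Pants.thetaFn_comp_leafPt hx]
    exact Pants.isBounded_expSum (Pants.δCoeff_pos hx) Pants.exists_norm_le_eightExp a
  obtain ⟨z₀, hz₀⟩ : ∃ z₀, ∀ z, z ≠ z₀ →
      fderiv ℝ (Pants.thetaFn ∘ Pants.leafPt x) z (z - z₀) < 0 := by
    rw [Pants.thetaFn_comp_leafPt hx]
    exact Pants.exists_center_expSum (Pants.δCoeff_pos hx) Pants.exists_norm_le_eightExp
  -- the leaf is the plane
  obtain ⟨P, hP⟩ : ∃ P : ℂ ≃ Q, ∀ z, Pants.coord (P z) = Pants.leafPt x z := by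
    refine ⟨⟨fun z => ⟨Pants.ofCoord (Pants.leafPt_mem hx z), ?_⟩,
      fun q => Pants.leafParam x (Pants.coord q), fun z => ?_, fun q => ?_⟩, fun z => ?_⟩
    · rw [hp]
      exact ⟨z, Pants.coord_ofCoord _⟩
    · simp only [Pants.coord_ofCoord, Pants.leafParam_leafPt hx]
    · obtain ⟨q, hq⟩ := q
      have hq' := hq
      rw [hp] at hq'
      obtain ⟨z, hz⟩ := hq'
      apply Subtype.ext
      apply Pants.coord_injective
      simp only [Pants.coord_ofCoord, hz, Pants.leafParam_leafPt hx]
    · exact Pants.coord_ofCoord _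
  have hval (z : ℂ) : Pants.trTheta (P z) = (Pants.thetaFn ∘ Pants.leafPt x) z := by
    rw [Pants.trTheta_eq, hP, Function.comp_apply]
  have hcurve (c : ℝ → Q) : Pants.IsHamiltonianCurveOn Pants.trTheta
      (fun t => (c t : Pants.FramedConvex)) Set.univ ↔ ∀ t, HasDerivAt (fun t => P.symm (c t))
        (Pants.planeField (Pants.thetaFn ∘ Pants.leafPt x) (P.symm (c t))) t :=
    Pants.isHamiltonianCurveOn_trTheta_iff hx fun t => by rw [← hP, P.apply_symm_apply]
  -- The flow on the leaf is the planar flow conjugated by `P`.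
  choose γ hγ0 hγ using Pants.exists_planeField_curve hG hb
  refine ⟨⟨P z₀, fun q' => ?_, fun q hq => ?_⟩, fun t q => P (γ (P.symm q) t), fun q => ⟨?_, ?_⟩,
    fun Ψ hΨ => ?_, fun q => ?_, P z₀, fun t => ?_, fun q hq => ?_⟩
  · obtain ⟨z, rfl⟩ := P.surjective q'
    rw [hval, hval]
    rcases eq_or_ne z z₀ with rfl | hz
    · exact le_rfl
    · exact (Pants.lt_of_ne_center hG hz₀ hz).le
  · obtain ⟨z, rfl⟩ := P.surjective q
    by_contra hne
    have := Pants.lt_of_ne_center hG hz₀ fun h => hne (congrArg P h)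
    rw [← hval, ← hval] at this
    exact (hq (P z₀)).not_gt this
  · simp only [hγ0, P.apply_symm_apply]
  · rw [hcurve]
    simpa only [P.symm_apply_apply] using hγ (P.symm q)
  · funext t q
    have h := (hcurve fun t => Ψ t q).mp (hΨ q).2
    have := Pants.planeField_curve_unique hG hb (by rw [hγ0, (hΨ q).1]) h (hγ (P.symm q))
    rw [← congrFun this t, P.apply_symm_apply]
  · obtain ⟨T, hT, hT'⟩ := Pants.exists_period hG hb hz₀ (hγ (P.symm q))
    exact ⟨T, hT, fun t => by simp only [hT']⟩
  · have : γ z₀ = fun _ => z₀ := Pants.planeField_curve_unique hG hb (hγ0 z₀) (hγ z₀) fun t => by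
      rw [Pants.planeField_center hG hz₀]
      exact hasDerivAt_const t z₀
    simp only [P.symm_apply_apply, this]
  · obtain ⟨z, rfl⟩ := P.surjective q
    by_contra hne
    have hz : z ≠ z₀ := fun h => hne (congrArg P h)
    -- A second fixed point would be a constant orbit, so the field would vanish there, against the
    -- positive angular velocity.
    have hconst : γ z = fun _ => z := by
      funext t
      have := hq t
      simpa only [P.symm_apply_apply, P.apply_eq_iff_eq] using this
    have h0 := hγ z 0
    rw [hconst] at h0
    have := h0.unique (hasDerivAt_const (0 : ℝ) z)
    have hpos := Pants.im_planeField_div_pos hz₀ hz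
    rw [this, zero_div, Complex.zero_im] at hpos
    exact hpos.false
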